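/- Conventions. Manifolds are smooth, finite-dimensional, Hausdorff and without boundary, and Riemannian metrics are smooth. A Sasakian manifold $M(\phi,\xi,\eta,g_M)$ is a Riemannian manifold $(M,g_M)$ with a smooth $(1,1)$-tensor field $\phi$, a smooth vector field $\xi$ and a smooth 1-form $\eta$ such that $\phi^2=-I+\eta\otimes\xi$, $\phi\xi=0$, $\eta\circ\phi=0$, $\eta(\xi)=1$, $g_M(\phi X,\phi Y)=g_M(X,Y)-\eta(X)\eta(Y)$, $\eta(X)=g_M(X,\xi)$, $d\eta(X,Y)=g_M(X,\phi Y)$ and $[\phi,\phi]+2\,d\eta\otimes\xi=0$. Here $2\,d\eta(X,Y)=X\eta(Y)-Y\eta(X)-\eta([X,Y])$ and $[\phi,\phi](X,Y)=\phi^2[X,Y]+[\phi X,\phi Y]-\phi[\phi X,Y]-\phi[X,\phi Y]$. A Riemannian submersion $F:(M,g_M)\to(N,g_N)$ is a smooth surjective map whose differential $F_*$ is surjective at every point and preserves the lengths of the vectors in $(\ker F_*)^{\perp}$. Vector fields in $\Gamma(\ker F_*)$ are called vertical, those in $\Gamma((\ker F_*)^\perp)$ horizontal, and $\mathcal V$,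 $\mathcal H$ are the orthogonal projections onto $\ker F_*$ and $(\ker F_*)^\perp$. With $\nabla$ the Levi-Civita connection of $g_M$, put $$\mathcal T_EG=\mathcal H\nabla_{\mathcal VE}\mathcal VG+\mathcal V\nabla_{\mathcal VE}\mathcal HG,\qquad \mathcal A_EG=\mathcal V\nabla_{\mathcal HE}\mathcal HG+\mathcal H\nabla_{\mathcal HE}\mathcal VG .$$ The second fundamental form of $F$ is $(\nabla F_*)(X,Y)=\nabla^F_XF_*Y-F_*(\nabla_XY)$ for smooth vector fields $X,Y$ on $M$, where $\nabla^F$ is the pullback to $F^{-1}TN$ of the Levi-Civita connection of $g_N$; $F$ is totally geodesic if $\nabla F_*=0$. Theorem. Let $M(\phi,\xi,\eta,g_M)$ be a Sasakian manifold, let $(N,g_N)$ be a Riemannian manifold, and let $F:M\to N$ be an anti-invariant Riemannian submersion, i.e. a Riemannian submersion with $\phi(\ker F_*)\subseteq(\ker F_*)^\perp$, such that $(\ker F_*)^\perp=\phi(\ker F_*)\oplus\langle\xi\rangle$. Then $F$ is a totally geodesic map if and only if $$\mathcal T_W\phi V=0\quad\text{for all } V,W\in\Gamma(\ker F_*)$$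 and $$\mathcal A_X\phi W=0\quad\text{for all } X\in\Gamma((\ker F_*)^\perp),\ W\in\Gamma(\ker F_*).$$ -/

import Mathlib

set_option linter.unusedSectionVars false

open scoped Manifold ContDiff Topology Bundle

namespace SasakianSubmersion

open Bundle VectorField FiberBundle

noncomputable section

/-! ### The Levi-Civita connection, built from the Koszul formula -/

section LeviCivita

variable {E : Type*} [NormedAddCommGroup E] [NormedSpace ℝ E] [FiniteDimensional ℝ E]
  {H : Type*} [TopologicalSpace H] (I : ModelWithCorners ℝ E H)
  {M : Type*} [TopologicalSpace M] [ChartedSpace H M] [IsManifold I ∞ M]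
  [RiemannianBundle (fun x : M ↦ TangentSpace I x)]
  [IsContMDiffRiemannianBundle I ∞ E (fun x : M ↦ TangentSpace I x)]

/-- The right-hand side of the Koszul formula for `g (∇_X Y, Z)` at the point `x`. -/
def koszul (X Y Z : Π x : M, TangentSpace I x) (x : M) : ℝ :=
  (1 / 2 : ℝ) *
    (mvfderiv I (fun y ↦ inner ℝ (Y y) (Z y)) x (X x)
      + mvfderiv I (fun y ↦ inner ℝ (X y) (Z y)) x (Y x)
      - mvfderiv I (fun y ↦ inner ℝ (X y) (Y y)) x (Z x)
      + inner ℝ (mlieBracket I X Y x) (Z x)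
      - inner ℝ (mlieBracket I X Z x) (Y x)
      - inner ℝ (mlieBracket I Y Z x) (X x))

instance (x : M) : FiniteDimensional ℝ (TangentSpace I x) := inferInstanceAs (FiniteDimensional ℝ E)

theorem mdifferentiableAt_inner {X Y : Π x : M, TangentSpace I x} {x : M}
    (hX : MDiffAt (T% X) x) (hY : MDiffAt (T% Y) x) :
    MDiffAt (fun y ↦ (inner ℝ (X y) (Y y) : ℝ)) x :=
  MDifferentiableAt.inner_bundle (F := E) (E := fun x : M ↦ TangentSpace I x) (IB := I)
    (b := fun y ↦ y) (v := X) (w := Y) hX hY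

theorem tensorialAt_koszul_left {Y Z : Π x : M, TangentSpace I x} {x : M}
    (hY : MDiffAt (T% Y) x) (hZ : MDiffAt (T% Z) x) :
    TensorialAt I E (fun X ↦ koszul I X Y Z x) x where
  smul {f X} hf hX := by
    have h1 := mvfderiv_mul hf (mdifferentiableAt_inner I hX hZ)
    have h2 := mvfderiv_mul hf (mdifferentiableAt_inner I hX hY)
    have e1 : (fun y ↦ inner ℝ ((f • X) y) (Z y)) = f * (fun y ↦ inner ℝ (X y) (Z y)) := by
      ext y; simp [inner_smul_left]
    have e2 : (fun y ↦ inner ℝ ((f • X) y) (Y y)) = f * (fun y ↦ inner ℝ (X y) (Y y)) := by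
      ext y; simp [inner_smul_left]
    simp only [koszul, e1, e2, h1, h2, mlieBracket_smul_left hf hX]
    simp [inner_add_left, inner_smul_left, inner_smul_right, inner_neg_left, real_inner_comm]
    ring
  add {X X'} hX hX' := by
    have h1 := mvfderiv_add (mdifferentiableAt_inner I hX hZ) (mdifferentiableAt_inner I hX' hZ)
    have h2 := mvfderiv_add (mdifferentiableAt_inner I hX hY) (mdifferentiableAt_inner I hX' hY)
    have e1 : (fun y ↦ inner ℝ ((X + X') y) (Z y)) =
        (fun y ↦ inner ℝ (X y) (Z y)) + (fun y ↦ inner ℝ (X' y) (Z y)) := by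
      ext y; simp [inner_add_left]
    have e2 : (fun y ↦ inner ℝ ((X + X') y) (Y y)) =
        (fun y ↦ inner ℝ (X y) (Y y)) + (fun y ↦ inner ℝ (X' y) (Y y)) := by
      ext y; simp [inner_add_left]
    simp only [koszul, e1, e2, h1, h2, mlieBracket_add_left hX hX']
    simp [inner_add_left, inner_add_right]
    ring

theorem tensorialAt_koszul_right {X Y : Π x : M, TangentSpace I x} {x : M}
    (hX : MDiffAt (T% X) x) (hY : MDiffAt (T% Y) x) :
    TensorialAt I E (fun Z ↦ koszul I X Y Z x) x where
  smul {f Z} hf hZ := by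
    have h1 := mvfderiv_mul hf (mdifferentiableAt_inner I hX hZ)
    have h2 := mvfderiv_mul hf (mdifferentiableAt_inner I hY hZ)
    have e1 : (fun y ↦ inner ℝ (X y) ((f • Z) y)) = f * (fun y ↦ inner ℝ (X y) (Z y)) := by
      ext y; simp [inner_smul_right]
    have e2 : (fun y ↦ inner ℝ (Y y) ((f • Z) y)) = f * (fun y ↦ inner ℝ (Y y) (Z y)) := by
      ext y; simp [inner_smul_right]
    simp only [koszul, e1, e2, h1, h2, mlieBracket_smul_right hf hZ]
    simp [inner_add_left, inner_smul_left, inner_smul_right, real_inner_comm]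
    ring
  add {Z Z'} hZ hZ' := by
    have h1 := mvfderiv_add (mdifferentiableAt_inner I hX hZ) (mdifferentiableAt_inner I hX hZ')
    have h2 := mvfderiv_add (mdifferentiableAt_inner I hY hZ) (mdifferentiableAt_inner I hY hZ')
    have e1 : (fun y ↦ inner ℝ (X y) ((Z + Z') y)) =
        (fun y ↦ inner ℝ (X y) (Z y)) + (fun y ↦ inner ℝ (X y) (Z' y)) := by
      ext y; simp [inner_add_right]
    have e2 : (fun y ↦ inner ℝ (Y y) ((Z + Z') y)) =
        (fun y ↦ inner ℝ (Y y) (Z y)) + (fun y ↦ inner ℝ (Y y) (Z' y)) := by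
      ext y; simp [inner_add_right]
    simp only [koszul, e1, e2, h1, h2, mlieBracket_add_right hZ hZ']
    simp [inner_add_left, inner_add_right]
    ring

open scoped Classical in
/-- `g (∇_v Y, w)` at `x`, as a bilinear form in `(v, w)`; zero if `Y` is not differentiable
at `x`. -/
def koszulForm (Y : Π x : M, TangentSpace I x) (x : M) :
    TangentSpace I x →L[ℝ] TangentSpace I x →L[ℝ] ℝ :=
  if hY : MDiffAt (T% Y) x then
    TensorialAt.mkHom₂ (fun X Z ↦ koszul I X Y Z x) x
      (fun _ hZ ↦ tensorialAt_koszul_left I hY hZ) (fun _ hX ↦ tensorialAt_koszul_right I hX hY)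
  else 0

instance (x : M) : CompleteSpace (TangentSpace I x) := FiniteDimensional.complete ℝ _

theorem koszulForm_apply {X Y Z : Π x : M, TangentSpace I x} {x : M} (hX : MDiffAt (T% X) x)
    (hY : MDiffAt (T% Y) x) (hZ : MDiffAt (T% Z) x) :
    koszulForm I Y x (X x) (Z x) = koszul I X Y Z x := by
  rw [koszulForm, dif_pos hY]
  exact TensorialAt.mkHom₂_apply _ _ hX hZ

/-- The covariant derivative `∇ Y`, as an endomorphism of each tangent space: `v ↦ ∇_v Y` is the vector
representing `w ↦ g (∇_v Y, w)`. -/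
def leviCivitaFun (Y : Π x : M, TangentSpace I x) (x : M) :
    TangentSpace I x →L[ℝ] TangentSpace I x :=
  LinearMap.toContinuousLinearMap
    { toFun := fun v ↦ (InnerProductSpace.toDual ℝ (TangentSpace I x)).symm (koszulForm I Y x v)
      map_add' := by intro v w; simp
      map_smul' := by intro c v; simp }

theorem inner_leviCivitaFun (Y : Π x : M, TangentSpace I x) (x : M) (v w : TangentSpace I x) :
    inner ℝ (leviCivitaFun I Y x v) w = koszulForm I Y x v w := by
  simp [leviCivitaFun]


theorem koszulForm_apply_extend {Y : Π x : M, TangentSpace I x} {x : M}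
    (hY : MDiffAt (T% Y) x) (v w : TangentSpace I x) :
    koszulForm I Y x v w
      = koszul I (extend E v) Y (extend E w) x := by
  rw [koszulForm, dif_pos hY]
  exact TensorialAt.mkHom₂_apply_eq_extend _ _ _ _

theorem koszul_add {X Y Y' Z : Π x : M, TangentSpace I x} {x : M} (hX : MDiffAt (T% X) x)
    (hY : MDiffAt (T% Y) x) (hY' : MDiffAt (T% Y') x) (hZ : MDiffAt (T% Z) x) :
    koszul I X (Y + Y') Z x = koszul I X Y Z x + koszul I X Y' Z x := by
  have h1 := mvfderiv_add (mdifferentiableAt_inner I hX hY) (mdifferentiableAt_inner I hX hY')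
  have h2 := mvfderiv_add (mdifferentiableAt_inner I hY hZ) (mdifferentiableAt_inner I hY' hZ)
  have e1 : (fun y ↦ (inner ℝ (X y) ((Y + Y') y) : ℝ)) =
      (fun y ↦ inner ℝ (X y) (Y y)) + (fun y ↦ inner ℝ (X y) (Y' y)) := by
    ext y; simp [inner_add_right]
  have e2 : (fun y ↦ (inner ℝ ((Y + Y') y) (Z y) : ℝ)) =
      (fun y ↦ inner ℝ (Y y) (Z y)) + (fun y ↦ inner ℝ (Y' y) (Z y)) := by
    ext y; simp [inner_add_left]
  simp only [koszul, e1, e2, h1, h2, mlieBracket_add_left hY hY', mlieBracket_add_right hY hY']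
  simp [inner_add_left, inner_add_right]
  ring

theorem koszul_smul {f : M → ℝ} {X Y Z : Π x : M, TangentSpace I x} {x : M}
    (hf : MDiffAt f x) (hX : MDiffAt (T% X) x)
    (hY : MDiffAt (T% Y) x) (hZ : MDiffAt (T% Z) x) :
    koszul I X (f • Y) Z x
      = f x * koszul I X Y Z x + mvfderiv I f x (X x) * inner ℝ (Y x) (Z x) := by
  have h1 := mvfderiv_mul hf (mdifferentiableAt_inner I hX hY)
  have h2 := mvfderiv_mul hf (mdifferentiableAt_inner I hY hZ)
  have e1 : (fun y ↦ (inner ℝ (X y) ((f • Y) y) : ℝ)) = f * (fun y ↦ inner ℝ (X y) (Y y)) := by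
    ext y; simp [inner_smul_right]
  have e2 : (fun y ↦ (inner ℝ ((f • Y) y) (Z y) : ℝ)) = f * (fun y ↦ inner ℝ (Y y) (Z y)) := by
    ext y; simp [inner_smul_left]
  simp only [koszul, e1, e2, h1, h2, mlieBracket_smul_left hf hY, mlieBracket_smul_right hf hY]
  simp [inner_add_left, inner_smul_left, inner_smul_right, inner_neg_left, real_inner_comm]
  ring

/-- The Levi-Civita connection of the Riemannian metric on `M`; `leviCivita I Y x v` is
`(∇_v Y)(x)`. The two theorems below say that it is metric and torsion-free. -/
def leviCivita : CovariantDerivative I E (fun x : M ↦ TangentSpace I x) where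
  toFun := leviCivitaFun I
  isCovariantDerivativeOnUniv :=
    { add := by
        intro Y Y' x hY hY' _
        ext v
        refine ext_inner_right ℝ fun w ↦ ?_
        simp only [add_apply, inner_add_left, inner_leviCivitaFun]
        rw [koszulForm_apply_extend I hY, koszulForm_apply_extend I hY',
          koszulForm_apply_extend I (mdifferentiableAt_add_section hY hY')]
        exact koszul_add I (mdifferentiableAt_extend I E _) hY hY' (mdifferentiableAt_extend I E _)
      leibniz := by
        intro Y f x hY hf _
        ext v
        refine ext_inner_right ℝ fun w ↦ ?_
        simp only [add_apply, smul_apply, inner_add_left,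
          ContinuousLinearMap.smulRight_apply, real_inner_smul_left, inner_leviCivitaFun]
        rw [koszulForm_apply_extend I hY, koszulForm_apply_extend I (hf.smul_section hY),
          koszul_smul I hf (mdifferentiableAt_extend I E _) hY (mdifferentiableAt_extend I E _)]
        simp }

theorem inner_leviCivita {X Y Z : Π x : M, TangentSpace I x} {x : M} (hX : MDiffAt (T% X) x)
    (hY : MDiffAt (T% Y) x) (hZ : MDiffAt (T% Z) x) :
    inner ℝ (leviCivita I Y x (X x)) (Z x) = koszul I X Y Z x := by
  rw [← koszulForm_apply I hX hY hZ]
  exact inner_leviCivitaFun I Y x (X x) (Z x)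

theorem mvfderiv_inner_leviCivita {X Y Z : Π x : M, TangentSpace I x} {x : M}
    (hX : MDiffAt (T% X) x) (hY : MDiffAt (T% Y) x) (hZ : MDiffAt (T% Z) x) :
    mvfderiv I (fun y ↦ (inner ℝ (Y y) (Z y) : ℝ)) x (X x)
      = inner ℝ (leviCivita I Y x (X x)) (Z x) + inner ℝ (Y x) (leviCivita I Z x (X x)) := by
  have h : ∀ u v : TangentSpace I x, (inner ℝ u v : ℝ) = inner ℝ v u := fun u v ↦
    real_inner_comm _ _
  rw [h (Y x), inner_leviCivita I hX hY hZ, inner_leviCivita I hX hZ hY, koszul, koszul]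
  have e1 : (fun y ↦ (inner ℝ (Z y) (Y y) : ℝ)) = fun y ↦ inner ℝ (Y y) (Z y) := by
    ext y; exact real_inner_comm _ _
  rw [e1, mlieBracket_swap_apply (V := Z) (W := Y)]
  simp only [inner_neg_left]
  ring

theorem torsion_leviCivita : (leviCivita I (M := M)).torsion = 0 := by
  rw [CovariantDerivative.torsion_eq_zero_iff]
  intro X Y x hX hY
  refine ext_inner_right ℝ fun w ↦ ?_
  obtain ⟨Z, hZ, rfl⟩ : ∃ Z : Π x : M, TangentSpace I x, MDiffAt (T% Z) x ∧ Z x = w :=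
    ⟨extend E w, mdifferentiableAt_extend I E _, by simp⟩
  rw [inner_sub_left, inner_leviCivita I hX hY hZ, inner_leviCivita I hY hX hZ, koszul, koszul]
  have e1 : (fun y ↦ (inner ℝ (Y y) (X y) : ℝ)) = fun y ↦ inner ℝ (X y) (Y y) := by
    ext y; exact real_inner_comm _ _
  rw [e1, mlieBracket_swap_apply (V := Y) (W := X)]
  simp only [inner_neg_left]
  ring

end LeviCivita

/-! ### The pullback connection and the second fundamental form of a map -/

section Maps

variable {E : Type*} [NormedAddCommGroup E] [NormedSpace ℝ E] [FiniteDimensional ℝ E]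
  {H : Type*} [TopologicalSpace H] (I : ModelWithCorners ℝ E H)
  {M : Type*} [TopologicalSpace M] [ChartedSpace H M] [IsManifold I ∞ M]
  [RiemannianBundle (fun x : M ↦ TangentSpace I x)]
  [IsContMDiffRiemannianBundle I ∞ E (fun x : M ↦ TangentSpace I x)]
  {E' : Type*} [NormedAddCommGroup E'] [NormedSpace ℝ E'] [FiniteDimensional ℝ E']
  {H' : Type*} [TopologicalSpace H'] (J : ModelWithCorners ℝ E' H')
  {N : Type*} [TopologicalSpace N] [ChartedSpace H' N] [IsManifold J ∞ N]
  [RiemannianBundle (fun x : N ↦ TangentSpace J x)]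
  [IsContMDiffRiemannianBundle J ∞ E' (fun x : N ↦ TangentSpace J x)]

/-- The pullback `∇^F` of the Levi-Civita connection of `N` to the bundle `F⁻¹TN` over `M`, applied
to a section `s` in the direction `v ∈ T_x M`. In a local trivialization `e` of `TN` around `F x`,
with associated frame `e_i`, and for `s = ∑ cⁱ (e_i ∘ F)`, this is
`∑ dcⁱ(v) e_i (F x) + ∑ cⁱ(x) (∇_{F_* v} e_i) (F x)`. -/
def pullbackCov (F : M → N) (s : Π x : M, TangentSpace J (F x)) (x : M) (v : TangentSpace I x) :
    TangentSpace J (F x) :=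
  let e := trivializationAt E' (fun z : N ↦ TangentSpace J z) (F x)
  let c : M → E' := fun y ↦ e.continuousLinearMapAt ℝ (F y) (s y)
  e.symmL ℝ (F x) (mvfderiv I c x v)
    + leviCivita J (fun z ↦ e.symmL ℝ z (c x)) (F x) (mfderiv I J F x v)

theorem mdifferentiableAt_coord {Z : Π z : N, TangentSpace J z} {q : N} (hZ : MDiffAt (T% Z) q) :
    MDiffAt (fun y ↦ (trivializationAt E' (fun z : N ↦ TangentSpace J z) q).continuousLinearMapAt
      ℝ y (Z y)) q := by
  refine ((mdifferentiableAt_section J Z).1 hZ).congr_of_eventuallyEq ?_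
  filter_upwards [(trivializationAt E' (fun z : N ↦ TangentSpace J z) q).open_baseSet.mem_nhds
    (mem_baseSet_trivializationAt' q)] with y hy
  rw [Trivialization.continuousLinearMapAt_apply, Trivialization.linearMapAt_apply, if_pos hy]

theorem mdifferentiableAt_symmL (q : N) (u : E') :
    MDiffAt (T% (fun z ↦ (trivializationAt E' (fun z : N ↦ TangentSpace J z) q).symmL ℝ z u :
      Π z : N, TangentSpace J z)) q := by
  set e := trivializationAt E' (fun z : N ↦ TangentSpace J z) q
  have hq : q ∈ e.baseSet := mem_baseSet_trivializationAt' q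
  rw [mdifferentiableAt_section]
  refine (mdifferentiableAt_const (c := u)).congr_of_eventuallyEq ?_
  filter_upwards [e.open_baseSet.mem_nhds hq] with y hy
  have := e.continuousLinearMapAt_symmL (R := ℝ) hy u
  rwa [Trivialization.continuousLinearMapAt_apply, Trivialization.linearMapAt_apply,
    if_pos hy] at this

theorem leviCivita_eq_coord {Z : Π z : N, TangentSpace J z} {q : N} (hZ : MDiffAt (T% Z) q)
    (w : TangentSpace J q) :
    let e := trivializationAt E' (fun z : N ↦ TangentSpace J z) q
    let c : N → E' := fun y ↦ e.continuousLinearMapAt ℝ y (Z y)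
    leviCivita J Z q w
      = e.symmL ℝ q (mvfderiv J c q w) + leviCivita J (fun z ↦ e.symmL ℝ z (c q)) q w := by
  intro e c
  have hq : q ∈ e.baseSet := mem_baseSet_trivializationAt' q
  let D : (Π z : N, TangentSpace J z) → TangentSpace J q := fun Z ↦ leviCivita J Z q w
    - e.symmL ℝ q (mvfderiv J (fun y ↦ e.continuousLinearMapAt ℝ y (Z y)) q w)
    - leviCivita J (fun z ↦ e.symmL ℝ z (e.continuousLinearMapAt ℝ q (Z q))) q w
  have hcov := (leviCivita J (M := N)).isCovariantDerivativeOn (s := Set.univ)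
  have hD : TensorialAt J E' D q := by
    constructor
    · intro f Z hf hZ
      have e1 : (fun y ↦ e.continuousLinearMapAt ℝ y ((f • Z) y))
          = f • (fun y ↦ e.continuousLinearMapAt ℝ y (Z y)) := by
        ext y; simp
      have e2 : (fun z ↦ e.symmL ℝ z (e.continuousLinearMapAt ℝ q ((f • Z) q)))
          = f q • (fun z ↦ e.symmL ℝ z (e.continuousLinearMapAt ℝ q (Z q))) := by
        ext y; simp
      have h3 : mvfderiv J (f • (fun y ↦ e.continuousLinearMapAt ℝ y (Z y))) q w
          = f q • mvfderiv J (fun y ↦ e.continuousLinearMapAt ℝ y (Z y)) q w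
            + mvfderiv J f q w • e.continuousLinearMapAt ℝ q (Z q) := by
        rw [mvfderiv_smul hf (mdifferentiableAt_coord J hZ)]; rfl
      have h4 : leviCivita J
          (f q • (fun z ↦ e.symmL ℝ z (e.continuousLinearMapAt ℝ q (Z q)))) q w
          = f q • leviCivita J
            (fun z ↦ e.symmL ℝ z (e.continuousLinearMapAt ℝ q (Z q))) q w := by
        rw [hcov.smul_const (f q)
          (mdifferentiableAt_symmL J q (e.continuousLinearMapAt ℝ q (Z q)))]; rfl
      have h5 : leviCivita J (f • Z) q w = f q • leviCivita J Z q w + mvfderiv J f q w • Z q := by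
        rw [hcov.leibniz hZ hf]; rfl
      have h6 := e.symmL_continuousLinearMapAt (R := ℝ) hq (Z q)
      simp only [D, e1, e2, h3, h4, h5, map_add, map_smul, h6]
      module
    · intro Z Z' hZ hZ'
      have e1 : (fun y ↦ e.continuousLinearMapAt ℝ y ((Z + Z') y))
          = (fun y ↦ e.continuousLinearMapAt ℝ y (Z y))
            + (fun y ↦ e.continuousLinearMapAt ℝ y (Z' y)) := by
        ext y; simp
      have e2 : (fun z ↦ e.symmL ℝ z (e.continuousLinearMapAt ℝ q ((Z + Z') q)))
          = (fun z ↦ e.symmL ℝ z (e.continuousLinearMapAt ℝ q (Z q)))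
            + (fun z ↦ e.symmL ℝ z (e.continuousLinearMapAt ℝ q (Z' q))) := by
        ext y; simp
      have h3 : mvfderiv J ((fun y ↦ e.continuousLinearMapAt ℝ y (Z y))
            + (fun y ↦ e.continuousLinearMapAt ℝ y (Z' y))) q w
          = mvfderiv J (fun y ↦ e.continuousLinearMapAt ℝ y (Z y)) q w
            + mvfderiv J (fun y ↦ e.continuousLinearMapAt ℝ y (Z' y)) q w := by
        rw [mvfderiv_add (mdifferentiableAt_coord J hZ) (mdifferentiableAt_coord J hZ')]; rfl
      have h4 : leviCivita J ((fun z ↦ e.symmL ℝ z (e.continuousLinearMapAt ℝ q (Z q)))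
            + (fun z ↦ e.symmL ℝ z (e.continuousLinearMapAt ℝ q (Z' q)))) q w
          = leviCivita J (fun z ↦ e.symmL ℝ z (e.continuousLinearMapAt ℝ q (Z q))) q w
            + leviCivita J (fun z ↦ e.symmL ℝ z (e.continuousLinearMapAt ℝ q (Z' q))) q w := by
        rw [hcov.add (mdifferentiableAt_symmL J q (e.continuousLinearMapAt ℝ q (Z q)))
          (mdifferentiableAt_symmL J q (e.continuousLinearMapAt ℝ q (Z' q)))]; rfl
      have h5 : leviCivita J (Z + Z') q w = leviCivita J Z q w + leviCivita J Z' q w := by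
        rw [hcov.add hZ hZ']; rfl
      simp only [D, e1, e2, h3, h4, h5, map_add]
      module
  have h0 := hD.pointwise hZ (mdifferentiableAt_symmL J q (c q))
    (e.symmL_continuousLinearMapAt (R := ℝ) hq (Z q)).symm
  have h1 : D (fun z ↦ e.symmL ℝ z (c q)) = 0 := by
    have h2 : mvfderiv J (fun y ↦ e.continuousLinearMapAt ℝ y (e.symmL ℝ y (c q))) q = 0 := by
      rw [← mvfderiv_const (I := J) (M := N) (c q) (x := q)]
      have : (fun y ↦ e.continuousLinearMapAt ℝ y (e.symmL ℝ y (c q))) =ᶠ[𝓝 q] fun _ ↦ c q := by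
        filter_upwards [e.open_baseSet.mem_nhds hq] with y hy
        exact e.continuousLinearMapAt_symmL (R := ℝ) hy (c q)
      ext w
      simp only [mvfderiv, ContinuousLinearMap.comp_apply]
      exact congrArg (fun L : TangentSpace J q →L[ℝ] E' ↦ L w) this.mfderiv_eq
    simp only [D]
    rw [h2, e.continuousLinearMapAt_symmL (R := ℝ) hq (c q)]
    simp
  rw [h1] at h0
  simp only [D] at h0
  rw [← sub_eq_zero, ← h0]
  simp only [c]; abel

/-- On a section of the form `Z ∘ F`, the pullback connection is `∇_{F_* v} Z`. -/
theorem pullbackCov_comp {F : M → N} {Z : Π z : N, TangentSpace J z} {x : M}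
    (hF : MDiffAt F x) (hZ : MDiffAt (T% Z) (F x)) (v : TangentSpace I x) :
    pullbackCov I J F (fun y ↦ Z (F y)) x v = leviCivita J Z (F x) (mfderiv I J F x v) := by
  rw [leviCivita_eq_coord J hZ, pullbackCov]
  congr 2
  exact mfderiv_comp_apply x (mdifferentiableAt_coord J hZ) hF v

/-- The second fundamental form `(∇F_*)(X, Y) = ∇^F_X (F_* Y) - F_* (∇_X Y)` of `F`. -/
def secondFundamentalForm (F : M → N) (X Y : Π x : M, TangentSpace I x) (x : M) :
    TangentSpace J (F x) :=
  pullbackCov I J F (fun y ↦ mfderiv I J F y (Y y)) x (X x)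
    - mfderiv I J F x (leviCivita I Y x (X x))

/-- A smooth vector field. -/
def IsSmoothField (X : Π x : M, TangentSpace I x) : Prop :=
  ContMDiff I I.tangent ∞ (fun x ↦ (⟨x, X x⟩ : TangentBundle I M))

/-- The map `F` is totally geodesic: `∇F_* = 0`. -/
def IsTotallyGeodesicMap (F : M → N) : Prop :=
  ∀ X Y : Π x : M, TangentSpace I x, IsSmoothField I X → IsSmoothField I Y →
    ∀ x, secondFundamentalForm I J F X Y x = 0

/-! ### Riemannian submersions and their fundamental tensors -/

/-- The vertical space `ker F_*` at `x`; its orthogonal complement is the horizontal space. -/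
def verticalSpace (F : M → N) (x : M) : Submodule ℝ (TangentSpace I x) :=
  LinearMap.ker (mfderiv I J F x).toLinearMap

/-- A vertical vector field. -/
def IsVertical (F : M → N) (X : Π x : M, TangentSpace I x) : Prop :=
  ∀ x, X x ∈ verticalSpace I J F x

/-- A horizontal vector field. -/
def IsHorizontal (F : M → N) (X : Π x : M, TangentSpace I x) : Prop :=
  ∀ x, X x ∈ (verticalSpace I J F x)ᗮ

/-- A Riemannian submersion: a smooth map onto `N`, of maximal rank, whose differential preserves
the lengths of horizontal vectors. -/
structure IsRiemannianSubmersion (F : M → N) : Prop where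
  contMDiff : ContMDiff I J ∞ F
  surjective : Function.Surjective F
  surjective_mfderiv : ∀ x, Function.Surjective (mfderiv I J F x)
  norm_mfderiv : ∀ x, ∀ v ∈ (verticalSpace I J F x)ᗮ, ‖mfderiv I J F x v‖ = ‖v‖

/-- The vertical part `𝒱X` of a vector field. -/
def vertPart (F : M → N) (X : Π x : M, TangentSpace I x) (x : M) : TangentSpace I x :=
  (verticalSpace I J F x).starProjection (X x)

/-- The horizontal part `ℋX` of a vector field. -/
def horPart (F : M → N) (X : Π x : M, TangentSpace I x) (x : M) : TangentSpace I x :=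
  ((verticalSpace I J F x)ᗮ).starProjection (X x)

/-- The covariant derivative `∇_X Y` of vector fields. -/
def nabla (X Y : Π x : M, TangentSpace I x) (x : M) : TangentSpace I x :=
  leviCivita I Y x (X x)

/-- The tensor `𝒯_X Y = ℋ∇_{𝒱X} 𝒱Y + 𝒱∇_{𝒱X} ℋY`. -/
def tensorT (F : M → N) (X Y : Π x : M, TangentSpace I x) (x : M) : TangentSpace I x :=
  horPart I J F (nabla I (vertPart I J F X) (vertPart I J F Y)) x
    + vertPart I J F (nabla I (vertPart I J F X) (horPart I J F Y)) x

/-- The tensor `𝒜_X Y = 𝒱∇_{ℋX} ℋY + ℋ∇_{ℋX} 𝒱Y`. -/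
def tensorA (F : M → N) (X Y : Π x : M, TangentSpace I x) (x : M) : TangentSpace I x :=
  vertPart I J F (nabla I (horPart I J F X) (horPart I J F Y)) x
    + horPart I J F (nabla I (horPart I J F X) (vertPart I J F Y)) x

end Maps

/-! ### Sasakian structures -/

section Sasakian

variable {E : Type*} [NormedAddCommGroup E] [NormedSpace ℝ E] [FiniteDimensional ℝ E]
  {H : Type*} [TopologicalSpace H] (I : ModelWithCorners ℝ E H)
  (M : Type*) [TopologicalSpace M] [ChartedSpace H M] [IsManifold I ∞ M]
  [RiemannianBundle (fun x : M ↦ TangentSpace I x)]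
  [IsContMDiffRiemannianBundle I ∞ E (fun x : M ↦ TangentSpace I x)]

/-- An almost contact metric structure `(φ, ξ, η, g)` on `M`, where `g` is the given Riemannian
metric. -/
structure AlmostContactMetricStructure where
  /-- The tensor field of type `(1, 1)`. -/
  φ : Π x : M, TangentSpace I x →L[ℝ] TangentSpace I x
  /-- The characteristic vector field. -/
  ξ : Π x : M, TangentSpace I x
  /-- The 1-form. -/
  η : Π x : M, TangentSpace I x →L[ℝ] ℝ
  smooth_φ : ContMDiff I (I.prod 𝓘(ℝ, E →L[ℝ] E)) ∞
    (fun x ↦ TotalSpace.mk' (E →L[ℝ] E)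
      (E := fun x : M ↦ TangentSpace I x →L[ℝ] TangentSpace I x) x (φ x))
  smooth_ξ : IsSmoothField I ξ
  smooth_η : ContMDiff I (I.prod 𝓘(ℝ, E →L[ℝ] ℝ)) ∞
    (fun x ↦ TotalSpace.mk' (E →L[ℝ] ℝ) (E := fun x : M ↦ TangentSpace I x →L[ℝ] ℝ) x (η x))
  φ_φ : ∀ x v, φ x (φ x v) = -v + η x v • ξ x
  φ_ξ : ∀ x, φ x (ξ x) = 0
  η_φ : ∀ x v, η x (φ x v) = 0
  η_ξ : ∀ x, η x (ξ x) = 1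
  inner_φ_φ : ∀ x v w, (inner ℝ (φ x v) (φ x w) : ℝ) = inner ℝ v w - η x v * η x w
  η_eq_inner : ∀ x v, η x v = inner ℝ v (ξ x)

namespace AlmostContactMetricStructure

variable {I M} (S : AlmostContactMetricStructure I M)

/-- The vector field `φX`. -/
def phi (X : Π x : M, TangentSpace I x) (x : M) : TangentSpace I x := S.φ x (X x)

/-- The exterior derivative of `η`, with the normalization
`2 dη(X, Y) = X(η(Y)) - Y(η(X)) - η([X, Y])`. -/
def dη (X Y : Π x : M, TangentSpace I x) (x : M) : ℝ :=
  (1 / 2 : ℝ) * (mvfderiv I (fun y ↦ S.η y (Y y)) x (X x)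
    - mvfderiv I (fun y ↦ S.η y (X y)) x (Y x) - S.η x (mlieBracket I X Y x))

/-- The Nijenhuis tensor `φ²[X, Y] + [φX, φY] - φ[φX, Y] - φ[X, φY]` of `φ`. -/
def nijenhuis (X Y : Π x : M, TangentSpace I x) (x : M) : TangentSpace I x :=
  S.φ x (S.φ x (mlieBracket I X Y x)) + mlieBracket I (S.phi X) (S.phi Y) x
    - S.φ x (mlieBracket I (S.phi X) Y x) - S.φ x (mlieBracket I X (S.phi Y) x)

/-- The structure is Sasakian: it is a contact metric structure, `dη(X, Y) = g(X, φY)`, and it is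
normal, `N + 2 dη ⊗ ξ = 0`. -/
structure IsSasakian : Prop where
  contact : ∀ X Y : Π x : M, TangentSpace I x, IsSmoothField I X → IsSmoothField I Y →
    ∀ x, S.dη X Y x = inner ℝ (X x) (S.φ x (Y x))
  normal : ∀ X Y : Π x : M, TangentSpace I x, IsSmoothField I X → IsSmoothField I Y →
    ∀ x, S.nijenhuis X Y x + (2 * S.dη X Y x) • S.ξ x = 0

end AlmostContactMetricStructure

end Sasakian

section AntiInvariant

variable {E : Type*} [NormedAddCommGroup E] [NormedSpace ℝ E] [FiniteDimensional ℝ E]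
  {H : Type*} [TopologicalSpace H] {I : ModelWithCorners ℝ E H}
  {M : Type*} [TopologicalSpace M] [ChartedSpace H M] [IsManifold I ∞ M]
  [RiemannianBundle (fun x : M ↦ TangentSpace I x)]
  [IsContMDiffRiemannianBundle I ∞ E (fun x : M ↦ TangentSpace I x)]
  {E' : Type*} [NormedAddCommGroup E'] [NormedSpace ℝ E'] [FiniteDimensional ℝ E']
  {H' : Type*} [TopologicalSpace H'] (J : ModelWithCorners ℝ E' H')
  {N : Type*} [TopologicalSpace N] [ChartedSpace H' N] [IsManifold J ∞ N]
  [RiemannianBundle (fun x : N ↦ TangentSpace J x)]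
  [IsContMDiffRiemannianBundle J ∞ E' (fun x : N ↦ TangentSpace J x)]

/-- An anti-invariant Riemannian submersion from a Sasakian manifold: a Riemannian submersion `F`
with `φ (ker F_*) ⊆ (ker F_*)ᗮ`. -/
structure IsAntiInvariantSubmersion (S : AlmostContactMetricStructure I M) (F : M → N) : Prop where
  isSasakian : S.IsSasakian
  isRiemannianSubmersion : IsRiemannianSubmersion I J F
  anti_invariant : ∀ x, (verticalSpace I J F x).map (S.φ x).toLinearMap ≤ (verticalSpace I J F x)ᗮ

end AntiInvariant

end

end SasakianSubmersion

open scoped Manifold ContDiff Topology Bundle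

namespace SasakianSubmersion

open Bundle VectorField FiberBundle

noncomputable section

section LieDerivative

variable {E : Type*} [NormedAddCommGroup E] [NormedSpace ℝ E] [FiniteDimensional ℝ E]
  {H : Type*} [TopologicalSpace H] {I : ModelWithCorners ℝ E H} [I.Boundaryless]
  {M : Type*} [TopologicalSpace M] [ChartedSpace H M] [IsManifold I ∞ M]
  {G : Type*} [NormedAddCommGroup G] [NormedSpace ℝ G]

/-- A vector field read in the preferred chart at `x`. -/
def chartField (I : ModelWithCorners ℝ E H) {M : Type*} [TopologicalSpace M] [ChartedSpace H M]
    (x : M) (X : Π y : M, TangentSpace I y) : E → E :=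
  mpullback 𝓘(ℝ, E) I (extChartAt I x).symm X

theorem differentiableAt_chartField {x : M} {X : Π y : M, TangentSpace I y}
    (hX : MDiffAt (T% X) x) : DifferentiableAt ℝ (chartField I x X) (extChartAt I x x) := by
  have := hX.mdifferentiableWithinAt (s := Set.univ)
    |>.differentiableWithinAt_mpullbackWithin_vectorField
  rw [I.range_eq_univ, Set.preimage_univ, Set.univ_inter, mpullbackWithin_univ] at this
  exact differentiableWithinAt_univ.1 this

theorem chartField_self (x : M) (X : Π y : M, TangentSpace I y) :
    chartField I x X (extChartAt I x x) = X x := by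
  have h := mfderivWithin_extChartAt_symm_inverse_apply (I := I) (x := x)
  rw [I.range_eq_univ, mfderivWithin_univ] at h
  have h2 : (X ((extChartAt I x).symm (extChartAt I x x)) : E) = X x :=
    congrArg (fun p ↦ (X p : E)) (extChartAt_to_inv x)
  exact (congrArg _ h2).trans (h (X x))

theorem mlieBracket_eq_lieBracket_chartField {x : M} (X Y : Π y : M, TangentSpace I y) :
    mlieBracket I X Y x = lieBracket ℝ (chartField I x X) (chartField I x Y)
      (extChartAt I x x) := by
  rw [mlieBracket, mlieBracketWithin_apply, I.range_eq_univ, Set.preimage_univ, Set.univ_inter,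
    mfderiv_extChartAt_self, mpullbackWithin_univ, mpullbackWithin_univ]
  exact (congrArg (fun L : E →L[ℝ] E ↦ L (lieBracketWithin ℝ (chartField I x X)
    (chartField I x Y) Set.univ (extChartAt I x x))) ContinuousLinearMap.inverse_id).trans
      (congrFun lieBracketWithin_univ _)

theorem two_le_infty : (2 : WithTop ℕ∞) ≤ ∞ := ENat.LEInfty.out

theorem mdifferentiableAt_extChartAt_symm {x : M} {z : E} (hz : z ∈ (extChartAt I x).target) :
    MDiffAt (extChartAt I x).symm z := by
  have := mdifferentiableWithinAt_extChartAt_symm (I := I) hz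
  rwa [I.range_eq_univ, mdifferentiableWithinAt_univ] at this

theorem mvfderiv_extChartAt_symm {x : M} {f : M → G} (X : Π y : M, TangentSpace I y) {z : E}
    (hz : z ∈ (extChartAt I x).target) (hf : MDiffAt f ((extChartAt I x).symm z)) :
    mvfderiv I f ((extChartAt I x).symm z) (X ((extChartAt I x).symm z))
      = fderiv ℝ (f ∘ (extChartAt I x).symm) z (chartField I x X z) := by
  have hi := isInvertible_mfderivWithin_extChartAt_symm (I := I) hz
  rw [I.range_eq_univ, mfderivWithin_univ] at hi
  have hs := mdifferentiableAt_extChartAt_symm (I := I) hz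
  have h1 : fderiv ℝ (f ∘ (extChartAt I x).symm) z
      = (mvfderiv I f ((extChartAt I x).symm z)).comp
        (mfderiv 𝓘(ℝ, E) I (extChartAt I x).symm z) := by
    rw [← mfderiv_eq_fderiv]
    exact mfderiv_comp z hf hs
  rw [h1]
  refine congrArg (mvfderiv I f ((extChartAt I x).symm z)) ?_
  exact (hi.self_apply_inverse _).symm

theorem mvfderiv_eq_fderiv_chartField {x : M} {f : M → G} (X : Π y : M, TangentSpace I y) {y : M}
    (hf : MDiffAt f y) (hy : y ∈ (extChartAt I x).source) :
    mvfderiv I f y (X y) = fderiv ℝ (f ∘ (extChartAt I x).symm) (extChartAt I x y)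
      (chartField I x X (extChartAt I x y)) := by
  have := mvfderiv_extChartAt_symm X ((extChartAt I x).map_source hy)
    (f := f) (by rwa [(extChartAt I x).left_inv hy])
  rwa [(extChartAt I x).left_inv hy] at this

theorem contDiffAt_comp_extChartAt_symm {x : M} {f : M → G} (hf : CMDiffAt ∞ f x) :
    ContDiffAt ℝ ∞ (f ∘ (extChartAt I x).symm) (extChartAt I x x) := by
  have := (contMDiffAt_iff.1 hf).2
  rw [I.range_eq_univ, contDiffWithinAt_univ] at this
  simpa using! this

theorem eventually_mvfderiv_eq {x : M} {f : M → G} (hf : CMDiffAt ∞ f x)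
    (X : Π y : M, TangentSpace I y) :
    (fun y ↦ mvfderiv I f y (X y)) =ᶠ[𝓝 x]
      (fun z ↦ fderiv ℝ (f ∘ (extChartAt I x).symm) z (chartField I x X z)) ∘ extChartAt I x := by
  have h1 : CMDiffAt 1 f x := hf.of_le (by simp)
  filter_upwards [extChartAt_source_mem_nhds (I := I) x,
    (contMDiffAt_iff_contMDiffAt_nhds (by simp)).1 h1] with y hy hfy
  exact mvfderiv_eq_fderiv_chartField X (hfy.mdifferentiableAt one_ne_zero) hy

theorem differentiableAt_fderiv_chartField {x : M} {f : M → G} (hf : CMDiffAt ∞ f x)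
    {X : Π y : M, TangentSpace I y} (hX : MDiffAt (T% X) x) :
    DifferentiableAt ℝ (fun z ↦ fderiv ℝ (f ∘ (extChartAt I x).symm) z (chartField I x X z))
      (extChartAt I x x) :=
  (((contDiffAt_comp_extChartAt_symm hf).fderiv_right (m := 1) two_le_infty).differentiableAt
    one_ne_zero).clm_apply (differentiableAt_chartField hX)

theorem mdifferentiableAt_mvfderiv {x : M} {f : M → G} (hf : CMDiffAt ∞ f x)
    {X : Π y : M, TangentSpace I y} (hX : MDiffAt (T% X) x) :
    MDiffAt (fun y ↦ mvfderiv I f y (X y)) x :=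
  ((differentiableAt_fderiv_chartField hf hX).comp_mdifferentiableAt
    (mdifferentiableAt_extChartAt (mem_chart_source H x))).congr_of_eventuallyEq
      (eventually_mvfderiv_eq hf X)

theorem mvfderiv_mvfderiv {x : M} {f : M → G} (hf : CMDiffAt ∞ f x)
    {X Y : Π y : M, TangentSpace I y} (hX : MDiffAt (T% X) x) :
    mvfderiv I (fun y ↦ mvfderiv I f y (X y)) x (Y x)
      = fderiv ℝ (fun z ↦ fderiv ℝ (f ∘ (extChartAt I x).symm) z (chartField I x X z))
        (extChartAt I x x) (chartField I x Y (extChartAt I x x)) := by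
  rw [mvfderiv_eq_fderiv_chartField Y (mdifferentiableAt_mvfderiv hf hX)
    (mem_extChartAt_source x)]
  congr 1
  apply Filter.EventuallyEq.fderiv_eq
  have h1 : Filter.Tendsto (extChartAt I x).symm (𝓝 (extChartAt I x x)) (𝓝 x) := by
    simpa [ContinuousAt] using! continuousAt_extChartAt_symm (I := I) x
  filter_upwards [h1.eventually (eventually_mvfderiv_eq hf X), extChartAt_target_mem_nhds x]
    with z hz hzt
  simp only [Function.comp_apply] at hz ⊢
  rw [hz, (extChartAt I x).right_inv hzt]

/-- The derivative along a Lie bracket is the commutator of the derivatives. -/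
theorem mvfderiv_mlieBracket {x : M} {f : M → G} (hf : CMDiffAt ∞ f x)
    {X Y : Π y : M, TangentSpace I y} (hX : MDiffAt (T% X) x) (hY : MDiffAt (T% Y) x) :
    mvfderiv I f x (mlieBracket I X Y x)
      = mvfderiv I (fun y ↦ mvfderiv I f y (Y y)) x (X x)
        - mvfderiv I (fun y ↦ mvfderiv I f y (X y)) x (Y x) := by
  rw [mvfderiv_mvfderiv hf hX, mvfderiv_mvfderiv hf hY,
    ← fderiv_apply_lieBracket (contDiffAt_comp_extChartAt_symm hf)
      (by simpa using two_le_infty)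
      (differentiableAt_chartField hY) (differentiableAt_chartField hX),
    mvfderiv_eq_fderiv_chartField _ (hf.mdifferentiableAt (by simp)) (mem_extChartAt_source x)]
  refine congrArg (fderiv ℝ (f ∘ (extChartAt I x).symm) (extChartAt I x x)) ?_
  rw [chartField_self]
  exact mlieBracket_eq_lieBracket_chartField X Y

end LieDerivative

section SecondFundamentalForm

variable {E : Type*} [NormedAddCommGroup E] [NormedSpace ℝ E] [FiniteDimensional ℝ E]
  {H : Type*} [TopologicalSpace H] {I : ModelWithCorners ℝ E H} [I.Boundaryless]
  {M : Type*} [TopologicalSpace M] [ChartedSpace H M] [IsManifold I ∞ M]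
  [RiemannianBundle (fun x : M ↦ TangentSpace I x)]
  [IsContMDiffRiemannianBundle I ∞ E (fun x : M ↦ TangentSpace I x)]
  {E' : Type*} [NormedAddCommGroup E'] [NormedSpace ℝ E'] [FiniteDimensional ℝ E']
  {H' : Type*} [TopologicalSpace H'] {J : ModelWithCorners ℝ E' H'} [J.Boundaryless]
  {N : Type*} [TopologicalSpace N] [ChartedSpace H' N] [IsManifold J ∞ N]
  [RiemannianBundle (fun x : N ↦ TangentSpace J x)]
  [IsContMDiffRiemannianBundle J ∞ E' (fun x : N ↦ TangentSpace J x)]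

theorem IsSmoothField.mdifferentiableAt {X : Π x : M, TangentSpace I x} (hX : IsSmoothField I X)
    (x : M) : MDiffAt (T% X) x :=
  ContMDiffAt.mdifferentiableAt (ContMDiff.contMDiffAt hX) (by simp)

variable (J) in
/-- The vector field near `q` that is constant in the preferred trivialization at `q`. -/
def coordField (q : N) (u : E') (z : N) : TangentSpace J z :=
  (trivializationAt E' (fun z : N ↦ TangentSpace J z) q).symmL ℝ z u

theorem mdifferentiableAt_coordField (q : N) (u : E') : MDiffAt (T% (coordField J q u)) q :=
  mdifferentiableAt_symmL J q u

theorem coordField_self (q : N) (w : TangentSpace J q) : coordField J q w q = w := by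
  have h := Trivialization.symmL_continuousLinearMapAt (R := ℝ)
    (trivializationAt E' (fun z : N ↦ TangentSpace J z) q) (mem_baseSet_trivializationAt' q) w
  rw [TangentBundle.continuousLinearMapAt_trivializationAt (mem_chart_source H' q)] at h
  have h2 : mfderiv J 𝓘(ℝ, E') (extChartAt J q) q w = w :=
    congrArg (fun L : E' →L[ℝ] E' ↦ L w) (mfderiv_extChartAt_self (I := J) (x := q))
  exact (congrArg (fun u ↦ coordField J q u q) h2).symm.trans h

theorem mvfderiv_extChartAt_coordField_of_mem {q z : N} (hz : z ∈ (chartAt H' q).source) (u : E') :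
    mvfderiv J (extChartAt J q) z (coordField J q u z) = u := by
  have h := Trivialization.continuousLinearMapAt_symmL (R := ℝ)
    (trivializationAt E' (fun z : N ↦ TangentSpace J z) q) hz u
  rw [TangentBundle.continuousLinearMapAt_trivializationAt hz] at h
  exact h

theorem mvfderiv_extChartAt_coordField (q : N) (u : E') :
    (fun z ↦ mvfderiv J (extChartAt J q) z (coordField J q u z)) =ᶠ[𝓝 q] fun _ ↦ u := by
  filter_upwards [(chartAt H' q).open_source.mem_nhds (mem_chart_source H' q)] with z hz
  exact mvfderiv_extChartAt_coordField_of_mem hz u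

theorem mlieBracket_coordField (q : N) (u v : E') :
    mlieBracket J (coordField J q u) (coordField J q v) q = 0 := by
  have h := mvfderiv_mlieBracket (contMDiffAt_extChartAt (I := J) (n := ∞) (x := q))
    (mdifferentiableAt_coordField q u) (mdifferentiableAt_coordField q v)
  have h1 : ∀ u : E', mvfderiv J (fun z ↦ mvfderiv J (extChartAt J q) z (coordField J q u z)) q
      = 0 := by
    intro u
    rw [← mvfderiv_const (I := J) (M := N) u (x := q)]
    ext w
    simp only [mvfderiv, ContinuousLinearMap.comp_apply]
    exact congrArg (fun L : TangentSpace J q →L[ℝ] E' ↦ L w)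
      (mvfderiv_extChartAt_coordField q u).mfderiv_eq
  rw [h1, h1] at h
  have h2 := congrArg (fun L : E' →L[ℝ] E' ↦ L (mlieBracket J (coordField J q u)
    (coordField J q v) q)) (mfderiv_extChartAt_self (I := J) (x := q))
  exact h2.symm.trans (h.trans (sub_self (0 : E')))

theorem leviCivita_coordField_comm (q : N) (u v : E') :
    leviCivita J (coordField J q u) q (coordField J q v q)
      = leviCivita J (coordField J q v) q (coordField J q u q) := by
  have h := (CovariantDerivative.torsion_eq_zero_iff (cov := leviCivita J (M := N))).1
    (torsion_leviCivita J) (mdifferentiableAt_coordField q v) (mdifferentiableAt_coordField q u)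
  rw [mlieBracket_coordField] at h
  exact sub_eq_zero.1 h

variable (J) in
/-- The coordinates of `F_* Y` in the preferred trivialization at `F x`. -/
def pushCoord (F : M → N) (x : M) (Y : Π y : M, TangentSpace I y)
    (y : M) : E' :=
  (trivializationAt E' (fun z : N ↦ TangentSpace J z) (F x)).continuousLinearMapAt ℝ (F y)
    (mfderiv I J F y (Y y))

theorem pushCoord_eventuallyEq {F : M → N} (hF : ContMDiff I J ∞ F) (x : M)
    (Y : Π y : M, TangentSpace I y) :
    pushCoord J F x Y =ᶠ[𝓝 x] fun y ↦ mvfderiv I (extChartAt J (F x) ∘ F) y (Y y) := by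
  filter_upwards [hF.continuous.continuousAt.preimage_mem_nhds
    ((chartAt H' (F x)).open_source.mem_nhds (mem_chart_source H' (F x)))] with y hy
  rw [pushCoord, TangentBundle.continuousLinearMapAt_trivializationAt hy]
  exact (mfderiv_comp_apply y (mdifferentiableAt_extChartAt hy)
    (hF.mdifferentiable (by simp) y) _).symm

theorem contMDiffAt_extChartAt_comp {F : M → N} (hF : ContMDiff I J ∞ F) (x : M) :
    CMDiffAt ∞ (extChartAt J (F x) ∘ F) x :=
  ContMDiffAt.comp x contMDiffAt_extChartAt hF.contMDiffAt

theorem mdifferentiableAt_pushCoord {F : M → N} (hF : ContMDiff I J ∞ F) {x : M}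
    {Y : Π y : M, TangentSpace I y} (hY : MDiffAt (T% Y) x) :
    MDiffAt (pushCoord J F x Y) x :=
  (mdifferentiableAt_mvfderiv (contMDiffAt_extChartAt_comp hF x) hY).congr_of_eventuallyEq
    (pushCoord_eventuallyEq hF x Y)

theorem coordField_pushCoord (F : M → N) (x : M) (Y : Π y : M, TangentSpace I y) :
    coordField J (F x) (pushCoord J F x Y x) (F x) = mfderiv I J F x (Y x) :=
  Trivialization.symmL_continuousLinearMapAt (R := ℝ) _ (mem_baseSet_trivializationAt' (F x)) _

theorem secondFundamentalForm_eq (F : M → N) (X Y : Π y : M, TangentSpace I y) (x : M) :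
    secondFundamentalForm I J F X Y x
      = coordField J (F x) (mvfderiv I (pushCoord J F x Y) x (X x)) (F x)
        + leviCivita J (coordField J (F x) (pushCoord J F x Y x)) (F x) (mfderiv I J F x (X x))
        - mfderiv I J F x (leviCivita I Y x (X x)) := rfl

theorem mvfderiv_pushCoord_sub {F : M → N} (hF : ContMDiff I J ∞ F) {x : M}
    {X Y : Π y : M, TangentSpace I y} (hX : MDiffAt (T% X) x) (hY : MDiffAt (T% Y) x) :
    mvfderiv I (pushCoord J F x Y) x (X x) - mvfderiv I (pushCoord J F x X) x (Y x)
      = pushCoord J F x (mlieBracket I X Y) x := by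
  have h1 : ∀ {Y : Π y : M, TangentSpace I y}, mvfderiv I (pushCoord J F x Y) x
      = mvfderiv I (fun y ↦ mvfderiv I (extChartAt J (F x) ∘ F) y (Y y)) x := by
    intro Y
    ext w
    simp only [mvfderiv, ContinuousLinearMap.comp_apply]
    exact congrArg (fun L : TangentSpace I x →L[ℝ] E' ↦ L w)
      (pushCoord_eventuallyEq hF x Y).mfderiv_eq
  rw [h1, h1, (pushCoord_eventuallyEq hF x _).self_of_nhds]
  simp only
  rw [mvfderiv_mlieBracket (contMDiffAt_extChartAt_comp hF x) hX hY]

theorem secondFundamentalForm_comm {F : M → N} (hF : ContMDiff I J ∞ F) {x : M}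
    {X Y : Π y : M, TangentSpace I y} (hX : MDiffAt (T% X) x) (hY : MDiffAt (T% Y) x) :
    secondFundamentalForm I J F X Y x = secondFundamentalForm I J F Y X x := by
  have h1 := (CovariantDerivative.torsion_eq_zero_iff (cov := leviCivita I (M := M))).1
    (torsion_leviCivita I) hX hY
  have h2 := congrArg (fun u ↦ coordField J (F x) u (F x))
    (mvfderiv_pushCoord_sub hF hX hY)
  have h3 := leviCivita_coordField_comm (J := J) (F x) (pushCoord J F x Y x) (pushCoord J F x X x)
  have h4 : ∀ u v : E', coordField J (F x) (u - v) (F x)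
      = coordField J (F x) u (F x) - coordField J (F x) v (F x) := fun u v ↦ map_sub _ _ _
  simp only [h4, coordField_pushCoord] at h2 h3
  rw [← h1, map_sub] at h2
  rw [secondFundamentalForm_eq, secondFundamentalForm_eq, h3]
  rw [← sub_eq_zero] at h2 ⊢
  rw [← h2]
  abel

theorem tensorialAt_secondFundamentalForm_left (F : M → N) (x : M)
    (Y : Π y : M, TangentSpace I y) :
    TensorialAt I E (fun X ↦ secondFundamentalForm I J F X Y x) x where
  smul {f X} _ _ := by
    simp only [secondFundamentalForm_eq, coordField, Pi.smul_apply', map_smul]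
    module
  add {X X'} _ _ := by
    simp only [secondFundamentalForm_eq, coordField, Pi.add_apply, map_add]
    abel

theorem tensorialAt_secondFundamentalForm_right {F : M → N} (hF : ContMDiff I J ∞ F) (x : M)
    (X : Π y : M, TangentSpace I y) :
    TensorialAt I E (fun Y ↦ secondFundamentalForm I J F X Y x) x where
  smul {f Y} hf hY := by
    have hcov := (leviCivita I (M := M)).isCovariantDerivativeOn (s := Set.univ)
    have hcov' := (leviCivita J (M := N)).isCovariantDerivativeOn (s := Set.univ)
    have h1 : pushCoord J F x (f • Y) = f • pushCoord J F x Y := by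
      ext y; simp [pushCoord]
    have h2 : mvfderiv I (f • pushCoord J F x Y) x (X x)
        = f x • mvfderiv I (pushCoord J F x Y) x (X x)
          + mvfderiv I f x (X x) • pushCoord J F x Y x := by
      rw [mvfderiv_smul hf (mdifferentiableAt_pushCoord hF hY)]; rfl
    have h3 : ∀ u v : E', coordField J (F x) (u + v) (F x)
        = coordField J (F x) u (F x) + coordField J (F x) v (F x) := fun u v ↦ map_add _ _ _
    have h4 : ∀ (r : ℝ) (v : E'), coordField J (F x) (r • v)
        = r • coordField J (F x) v := fun r v ↦ funext fun z ↦ map_smul _ _ _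
    have h5 : leviCivita I (f • Y) x (X x)
        = f x • leviCivita I Y x (X x) + mvfderiv I f x (X x) • Y x := by
      rw [hcov.leibniz hY hf]; rfl
    have h6 : ∀ w, leviCivita J (f x • coordField J (F x) (pushCoord J F x Y x)) (F x) w
        = f x • leviCivita J (coordField J (F x) (pushCoord J F x Y x)) (F x) w := by
      intro w
      rw [hcov'.smul_const (f x) (mdifferentiableAt_coordField _ _)]; rfl
    simp only [secondFundamentalForm_eq, h1, h2, h3, h5, Pi.smul_apply', h4, h6, map_add, map_smul,
      Pi.smul_apply, coordField_pushCoord]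
    module
  add {Y Y'} hY hY' := by
    have hcov := (leviCivita I (M := M)).isCovariantDerivativeOn (s := Set.univ)
    have hcov' := (leviCivita J (M := N)).isCovariantDerivativeOn (s := Set.univ)
    have h1 : pushCoord J F x (Y + Y') = pushCoord J F x Y + pushCoord J F x Y' := by
      ext y; simp [pushCoord]
    have h2 : mvfderiv I (pushCoord J F x Y + pushCoord J F x Y') x (X x)
        = mvfderiv I (pushCoord J F x Y) x (X x) + mvfderiv I (pushCoord J F x Y') x (X x) := by
      rw [mvfderiv_add (mdifferentiableAt_pushCoord hF hY) (mdifferentiableAt_pushCoord hF hY')]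
      rfl
    have h3 : ∀ u v : E', coordField J (F x) (u + v)
        = coordField J (F x) u + coordField J (F x) v := fun u v ↦ funext fun z ↦ map_add _ _ _
    have h5 : leviCivita I (Y + Y') x (X x)
        = leviCivita I Y x (X x) + leviCivita I Y' x (X x) := by
      rw [hcov.add hY hY']; rfl
    have h6 : ∀ u v w, leviCivita J (coordField J (F x) u + coordField J (F x) v) (F x) w
        = leviCivita J (coordField J (F x) u) (F x) w
          + leviCivita J (coordField J (F x) v) (F x) w := by
      intro u v w
      rw [hcov'.add (mdifferentiableAt_coordField _ _) (mdifferentiableAt_coordField _ _)]; rfl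
    simp only [secondFundamentalForm_eq, h1, h2, h3, h5, h6, Pi.add_apply, map_add]
    abel

/-- The second fundamental form at a point, as a bilinear map. -/
def secondFundamentalFormAt {F : M → N} (hF : ContMDiff I J ∞ F) (x : M) :
    TangentSpace I x →L[ℝ] TangentSpace I x →L[ℝ] TangentSpace J (F x) :=
  TensorialAt.mkHom₂ (fun X Y ↦ secondFundamentalForm I J F X Y x) x
    (fun Y _ ↦ tensorialAt_secondFundamentalForm_left F x Y)
    (fun X _ ↦ tensorialAt_secondFundamentalForm_right hF x X)

theorem secondFundamentalFormAt_apply {F : M → N} (hF : ContMDiff I J ∞ F) {x : M}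
    {X Y : Π y : M, TangentSpace I y} (hX : MDiffAt (T% X) x) (hY : MDiffAt (T% Y) x) :
    secondFundamentalFormAt hF x (X x) (Y x) = secondFundamentalForm I J F X Y x :=
  TensorialAt.mkHom₂_apply _ _ hX hY

theorem secondFundamentalFormAt_comm {F : M → N} (hF : ContMDiff I J ∞ F) {x : M}
    (v w : TangentSpace I x) :
    secondFundamentalFormAt hF x v w = secondFundamentalFormAt hF x w v :=
  secondFundamentalForm_comm hF (mdifferentiableAt_extend ..) (mdifferentiableAt_extend ..)

end SecondFundamentalForm

section Extension

variable {E : Type*} [NormedAddCommGroup E] [NormedSpace ℝ E] [FiniteDimensional ℝ E]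
  {H : Type*} [TopologicalSpace H] {I : ModelWithCorners ℝ E H} [I.Boundaryless]
  {M : Type*} [TopologicalSpace M] [ChartedSpace H M] [IsManifold I ∞ M]
  [RiemannianBundle (fun x : M ↦ TangentSpace I x)]
  [IsContMDiffRiemannianBundle I ∞ E (fun x : M ↦ TangentSpace I x)]
  {E' : Type*} [NormedAddCommGroup E'] [NormedSpace ℝ E'] [FiniteDimensional ℝ E']
  {H' : Type*} [TopologicalSpace H'] {J : ModelWithCorners ℝ E' H'} [J.Boundaryless]
  {N : Type*} [TopologicalSpace N] [ChartedSpace H' N] [IsManifold J ∞ N]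
  [RiemannianBundle (fun x : N ↦ TangentSpace J x)]
  [IsContMDiffRiemannianBundle J ∞ E' (fun x : N ↦ TangentSpace J x)]

theorem exists_contDiffOn_fderiv_apply_eq {g : E → E'} {O : Set E} (hO : IsOpen O) {z₀ : E}
    (hz₀ : z₀ ∈ O) (hg : ContDiffOn ℝ ∞ g O) (hs : Function.Surjective (fderiv ℝ g z₀)) (w : E) :
    ∃ V ⊆ O, IsOpen V ∧ z₀ ∈ V ∧ ∃ u : E → E, ContDiffOn ℝ ∞ u V ∧ u z₀ = w ∧
      ∀ z ∈ V, fderiv ℝ g z (u z) = fderiv ℝ g z₀ w := by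
  obtain ⟨R, hR⟩ := (fderiv ℝ g z₀).exists_rightInverse_of_surjective
    (LinearMap.range_eq_top.2 hs)
  have hA : ContDiffOn ℝ ∞ (fderiv ℝ g) O := hg.fderiv_of_isOpen hO (by simp)
  have hP : ContDiffOn ℝ ∞ (fun z ↦ (fderiv ℝ g z).comp R) O := hA.clm_comp contDiffOn_const
  let U : Set (E' →L[ℝ] E') := Set.range ((↑) : (E' ≃L[ℝ] E') → E' →L[ℝ] E')
  have hU : IsOpen U := ContinuousLinearEquiv.isOpen
  refine ⟨O ∩ (fun z ↦ (fderiv ℝ g z).comp R) ⁻¹' U, Set.inter_subset_left,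
    hP.continuousOn.isOpen_inter_preimage hO hU, ⟨hz₀, ContinuousLinearEquiv.refl ℝ E', hR.symm⟩,
    fun z ↦ w + R (((fderiv ℝ g z).comp R).inverse (fderiv ℝ g z₀ w - fderiv ℝ g z w)), ?_, ?_, ?_⟩
  · rintro z ⟨hz, e, he⟩
    have hA' := (hA z hz).contDiffAt (hO.mem_nhds hz)
    have hinv : ContDiffAt ℝ ∞ (fun z ↦ ((fderiv ℝ g z).comp R).inverse) z := by
      refine ContDiffAt.comp z (g := ContinuousLinearMap.inverse)
        (f := fun z ↦ (fderiv ℝ g z).comp R) ?_ ((hP z hz).contDiffAt (hO.mem_nhds hz))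
      have := contDiffAt_map_inverse (𝕜 := ℝ) (n := ∞) e
      rwa [show (e : E' →L[ℝ] E') = (fderiv ℝ g z).comp R from he] at this
    have hsub : ContDiffAt ℝ ∞ (fun z ↦ fderiv ℝ g z₀ w - fderiv ℝ g z w) z :=
      contDiffAt_const.sub (hA'.clm_apply contDiffAt_const)
    exact (contDiffAt_const.add
      ((contDiffAt_const (c := R)).clm_apply (hinv.clm_apply hsub))).contDiffWithinAt
  · simp
  · rintro z ⟨hz, e, he⟩
    have h1 : ((fderiv ℝ g z).comp R).IsInvertible := ⟨e, he⟩
    have h2 := h1.self_apply_inverse (fderiv ℝ g z₀ w - fderiv ℝ g z w)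
    rw [ContinuousLinearMap.comp_apply] at h2
    rw [map_add, h2]
    abel

theorem chartField_coordField {x y : M} (hy : y ∈ (chartAt H x).source) (u : M → E) :
    chartField I x (fun y ↦ coordField I x (u y) y) (extChartAt I x y) = u y := by
  have hy' : y ∈ (extChartAt I x).source := by rwa [extChartAt_source]
  have h := mvfderiv_eq_fderiv_chartField (fun y ↦ coordField I x (u y) y)
    (mdifferentiableAt_extChartAt hy) hy'
  rw [mvfderiv_extChartAt_coordField_of_mem hy] at h
  have h1 : extChartAt I x ∘ (extChartAt I x).symm =ᶠ[𝓝 (extChartAt I x y)] id := by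
    filter_upwards [extChartAt_target_mem_nhds' ((extChartAt I x).map_source hy')] with z hz
    exact (extChartAt I x).right_inv hz
  rw [h1.fderiv_eq, fderiv_id] at h
  exact h.symm

theorem contMDiffOn_coordField {x : M} {u : M → E} {V : Set M} (hV : IsOpen V)
    (hVx : V ⊆ (chartAt H x).source) (hu : CMDiff[V] ∞ u) :
    CMDiff[V] ∞ (T% (fun y ↦ coordField I x (u y) y)) := by
  rw [Trivialization.contMDiffOn_section_iff
    (e := trivializationAt E (fun z : M ↦ TangentSpace I z) x) hV hVx]
  refine hu.congr fun y hy ↦ ?_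
  have h := Trivialization.continuousLinearMapAt_symmL (R := ℝ)
    (trivializationAt E (fun z : M ↦ TangentSpace I z) x) (hVx hy) (u y)
  rwa [Trivialization.continuousLinearMapAt_apply, Trivialization.linearMapAt_apply,
    if_pos (show y ∈ (trivializationAt E (fun z : M ↦ TangentSpace I z) x).baseSet from hVx hy)]
    at h

theorem mfderiv_eq_coordField {F : M → N} {x y : M} {v : TangentSpace I y} {q : E'}
    (hF : MDiffAt F y) (hy : F y ∈ (chartAt H' (F x)).source)
    (h : mvfderiv I (extChartAt J (F x) ∘ F) y v = q) :
    mfderiv I J F y v = coordField J (F x) q (F y) := by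
  rw [← h]
  have h1 : mvfderiv I (extChartAt J (F x) ∘ F) y v
      = (trivializationAt E' (fun z : N ↦ TangentSpace J z) (F x)).continuousLinearMapAt ℝ (F y)
        (mfderiv I J F y v) := by
    rw [TangentBundle.continuousLinearMapAt_trivializationAt hy]
    exact mfderiv_comp_apply y (mdifferentiableAt_extChartAt hy) hF _
  rw [h1]
  exact (Trivialization.symmL_continuousLinearMapAt (R := ℝ) _ hy _).symm

/-- A tangent vector at `x` extends to a smooth vector field which near `x` is `F`-related to a
coordinate field of `N`. -/
theorem exists_isSmoothField_mfderiv_eq [T2Space M] {F : M → N} (hF : ContMDiff I J ∞ F) {x : M}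
    (hs : Function.Surjective (mfderiv I J F x)) (w : TangentSpace I x) :
    ∃ Y : Π y : M, TangentSpace I y, IsSmoothField I Y ∧ Y x = w ∧ ∃ f : M → ℝ, f =ᶠ[𝓝 x] 1 ∧
      ∀ y, mfderiv I J F y (Y y) = f y • coordField J (F x) (mfderiv I J F x w) (F y) := by
  set g : E → E' := (extChartAt J (F x) ∘ F) ∘ (extChartAt I x).symm with hg
  have hgO := (contMDiff_iff.1 hF).2 x (F x)
  set O := (extChartAt I x).target ∩ (extChartAt I x).symm ⁻¹' (F ⁻¹' (extChartAt J (F x)).source)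
  have hO : IsOpen O := (continuousOn_extChartAt_symm x).isOpen_inter_preimage
    (isOpen_extChartAt_target x) (hF.continuous.isOpen_preimage _ (isOpen_extChartAt_source _))
  have hx₀ : extChartAt I x x ∈ O := ⟨mem_extChartAt_target x, by simp⟩
  have hder : ∀ v : TangentSpace I x, fderiv ℝ g (extChartAt I x x) v = mfderiv I J F x v := by
    intro v
    have h1 := mvfderiv_eq_fderiv_chartField (coordField I x v)
      ((contMDiffAt_extChartAt_comp hF x).mdifferentiableAt (by simp)) (mem_extChartAt_source x)
    rw [chartField_self, coordField_self] at h1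
    have h2 : mvfderiv I (extChartAt J (F x) ∘ F) x v
        = mfderiv J 𝓘(ℝ, E') (extChartAt J (F x)) (F x) (mfderiv I J F x v) :=
      mfderiv_comp_apply x (mdifferentiableAt_extChartAt (mem_chart_source H' (F x)))
        (hF.mdifferentiable (by simp) x) v
    rw [mfderiv_extChartAt_self] at h2
    exact h1.symm.trans h2
  have hs' : Function.Surjective (fderiv ℝ g (extChartAt I x x)) := by
    intro q
    obtain ⟨v, hv⟩ := hs q
    exact ⟨v, (hder v).trans hv⟩
  obtain ⟨V, hVO, hV, hxV, u, hu, hux, hVu⟩ :=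
    exists_contDiffOn_fderiv_apply_eq hO hx₀ hgO hs' w
  set V' : Set M := (extChartAt I x).source ∩ extChartAt I x ⁻¹' V
  have hV' : IsOpen V' := (continuousOn_extChartAt x).isOpen_inter_preimage
    (isOpen_extChartAt_source x) hV
  have hxV' : x ∈ V' := ⟨mem_extChartAt_source x, hxV⟩
  have hVc : V' ⊆ (chartAt H x).source := fun y hy ↦ by simpa using! hy.1
  have hu' : CMDiff[V'] ∞ (u ∘ extChartAt I x) :=
    hu.contMDiffOn.comp ((contMDiffOn_extChartAt (I := I) (x := x)).mono hVc) fun y hy ↦ hy.2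
  let Z : Π y : M, TangentSpace I y := fun y ↦ coordField I x ((u ∘ extChartAt I x) y) y
  have hZ : ∀ y ∈ V', mfderiv I J F y (Z y) = coordField J (F x) (mfderiv I J F x w) (F y) := by
    intro y hy
    have hyF : F y ∈ (extChartAt J (F x)).source := by
      have := (hVO hy.2).2
      rwa [Set.mem_preimage, (extChartAt I x).left_inv hy.1] at this
    refine mfderiv_eq_coordField (hF.mdifferentiable (by simp) y) (by simpa using! hyF) ?_
    have hd : MDiffAt (extChartAt J (F x) ∘ F) y :=
      MDifferentiableAt.comp y (mdifferentiableAt_extChartAt (by simpa using! hyF))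
        (hF.mdifferentiable (by simp) y)
    rw [mvfderiv_eq_fderiv_chartField Z hd hy.1, chartField_coordField (hVc hy)]
    exact (hVu _ hy.2).trans (hder w)
  obtain ⟨f, hf, -⟩ := ((SmoothBumpFunction.nhds_basis_support (I := I)
    (hV'.mem_nhds hxV')).mem_iff.1 (hV'.mem_nhds hxV'))
  refine ⟨(f : M → ℝ) • Z, ContMDiffOn.smul_section_of_tsupport f.contMDiff.contMDiffOn hV' hf
    (contMDiffOn_coordField hV' hVc hu'), ?_, f, f.eventuallyEq_one, fun y ↦ ?_⟩
  · rw [Pi.smul_apply', f.eq_one, one_smul]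
    exact (congrArg (fun v ↦ coordField I x v x) hux).trans (coordField_self x w)
  · rw [Pi.smul_apply', map_smul]
    by_cases hy : y ∈ V'
    · rw [hZ y hy]
    · rw [image_eq_zero_of_notMem_tsupport fun h ↦ hy (hf h), zero_smul, zero_smul]

end Extension

section Submersion

variable {E : Type*} [NormedAddCommGroup E] [NormedSpace ℝ E] [FiniteDimensional ℝ E]
  {H : Type*} [TopologicalSpace H] {I : ModelWithCorners ℝ E H} [I.Boundaryless]
  {M : Type*} [TopologicalSpace M] [ChartedSpace H M] [IsManifold I ∞ M]
  [RiemannianBundle (fun x : M ↦ TangentSpace I x)]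
  [IsContMDiffRiemannianBundle I ∞ E (fun x : M ↦ TangentSpace I x)]
  {E' : Type*} [NormedAddCommGroup E'] [NormedSpace ℝ E'] [FiniteDimensional ℝ E']
  {H' : Type*} [TopologicalSpace H'] {J : ModelWithCorners ℝ E' H'} [J.Boundaryless]
  {N : Type*} [TopologicalSpace N] [ChartedSpace H' N] [IsManifold J ∞ N]
  [RiemannianBundle (fun x : N ↦ TangentSpace J x)]
  [IsContMDiffRiemannianBundle J ∞ E' (fun x : N ↦ TangentSpace J x)]

theorem mvfderiv_eq_zero_of_isLocalMin {f : M → ℝ} {x : M} (hf : MDiffAt f x)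
    (h : IsLocalMin f x) : mvfderiv I f x = 0 := by
  ext v
  have h1 := mvfderiv_eq_fderiv_chartField (coordField I x v) hf (mem_extChartAt_source x)
  have h2 : IsLocalMin (f ∘ (extChartAt I x).symm) (extChartAt I x x) :=
    IsLocalMin.comp_continuous (by rwa [extChartAt_to_inv])
      (continuousAt_extChartAt_symm (I := I) x)
  rw [h2.fderiv_eq_zero, coordField_self] at h1
  exact h1

theorem mvfderiv_inner_self (x : M) {Y : Π y : M, TangentSpace I y} (hY : MDiffAt (T% Y) x)
    (v : TangentSpace I x) :
    mvfderiv I (fun y ↦ (inner ℝ (Y y) (Y y) : ℝ)) x v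
      = 2 * inner ℝ (leviCivita I Y x v) (Y x) := by
  have h := mvfderiv_inner_leviCivita I (mdifferentiableAt_coordField (J := I) x v) hY hY
  rw [coordField_self] at h
  rw [h, real_inner_comm (Y x)]
  ring

namespace IsRiemannianSubmersion

variable {F : M → N} (hF : IsRiemannianSubmersion I J F)
include hF

theorem inner_mfderiv_of_mem {x : M} {h k : TangentSpace I x}
    (hh : h ∈ (verticalSpace I J F x)ᗮ) (hk : k ∈ (verticalSpace I J F x)ᗮ) :
    (inner ℝ (mfderiv I J F x h) (mfderiv I J F x k) : ℝ) = inner ℝ h k := by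
  rw [real_inner_eq_norm_add_mul_self_sub_norm_mul_self_sub_norm_mul_self_div_two,
    real_inner_eq_norm_add_mul_self_sub_norm_mul_self_sub_norm_mul_self_div_two, ← map_add,
    hF.norm_mfderiv x h hh, hF.norm_mfderiv x k hk,
    hF.norm_mfderiv x (h + k) (Submodule.add_mem _ hh hk)]

theorem exists_horizontal (x : M) (v : TangentSpace I x) :
    ∃ u ∈ verticalSpace I J F x, ∃ h ∈ (verticalSpace I J F x)ᗮ, v = u + h := by
  refine ⟨(verticalSpace I J F x).starProjection v, Submodule.starProjection_apply_mem _ _,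
    v - (verticalSpace I J F x).starProjection v,
    Submodule.sub_starProjection_mem_orthogonal v, ?_⟩
  abel

theorem inner_mfderiv {x : M} (v : TangentSpace I x) {h : TangentSpace I x}
    (hh : h ∈ (verticalSpace I J F x)ᗮ) :
    (inner ℝ (mfderiv I J F x v) (mfderiv I J F x h) : ℝ) = inner ℝ v h := by
  obtain ⟨u, hu, k, hk, rfl⟩ := hF.exists_horizontal x v
  have hu' : mfderiv I J F x u = 0 := hu
  rw [map_add, hu', zero_add, hF.inner_mfderiv_of_mem hk hh, inner_add_left,
    Submodule.inner_right_of_mem_orthogonal hu hh, zero_add]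

theorem inner_mfderiv_self_le {x : M} (v : TangentSpace I x) :
    (inner ℝ (mfderiv I J F x v) (mfderiv I J F x v) : ℝ) ≤ inner ℝ v v := by
  obtain ⟨u, hu, k, hk, rfl⟩ := hF.exists_horizontal x v
  have hu' : mfderiv I J F x u = 0 := hu
  have h1 := Submodule.inner_right_of_mem_orthogonal hu hk
  have h2 := Submodule.inner_left_of_mem_orthogonal hu hk
  rw [map_add, hu', zero_add, hF.inner_mfderiv_of_mem hk hk, inner_add_left, inner_add_right,
    inner_add_right, h1, h2]
  have := real_inner_self_nonneg (x := u)
  linarith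

theorem exists_horizontal_mfderiv_eq (x : M) (q : TangentSpace J (F x)) :
    ∃ h ∈ (verticalSpace I J F x)ᗮ, mfderiv I J F x h = q := by
  obtain ⟨v, rfl⟩ := hF.surjective_mfderiv x q
  obtain ⟨u, hu, k, hk, rfl⟩ := hF.exists_horizontal x v
  have hu' : mfderiv I J F x u = 0 := hu
  exact ⟨k, hk, by rw [map_add, hu', zero_add]⟩

/-- A vertical vector extends to a smooth vertical vector field. -/
theorem exists_vertical_field [T2Space M] {x : M} {u : TangentSpace I x}
    (hu : u ∈ verticalSpace I J F x) :
    ∃ U : Π y : M, TangentSpace I y, IsSmoothField I U ∧ IsVertical I J F U ∧ U x = u := by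
  obtain ⟨U, hU, hUx, f, -, hf⟩ :=
    exists_isSmoothField_mfderiv_eq hF.contMDiff (hF.surjective_mfderiv x) u
  refine ⟨U, hU, fun y ↦ ?_, hUx⟩
  have hu' : mfderiv I J F x u = 0 := hu
  have h0 : coordField J (F x) (0 : TangentSpace J (F x)) (F y) = 0 := map_zero _
  have := hf y
  rwa [hu', h0, smul_zero] at this

theorem secondFundamentalFormAt_vertical {x : M} (w : TangentSpace I x)
    {U : Π y : M, TangentSpace I y} (hU : MDiffAt (T% U) x) (hUv : IsVertical I J F U) :
    secondFundamentalFormAt hF.contMDiff x w (U x) = -mfderiv I J F x (leviCivita I U x w) := by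
  have h1 := secondFundamentalFormAt_apply hF.contMDiff
    (mdifferentiableAt_coordField (J := I) x w) hU
  rw [coordField_self] at h1
  have h2 : pushCoord J F x U = fun _ ↦ 0 := by
    ext y
    have : mfderiv I J F y (U y) = 0 := hUv y
    rw [pushCoord, this, map_zero]
  have h3 : coordField J (F x) 0 = 0 := funext fun z ↦ map_zero _
  have h4 : leviCivita J (0 : Π z : N, TangentSpace J z) = 0 :=
    (leviCivita J).zero
  rw [h1, secondFundamentalForm_eq, h2, mvfderiv_const]
  simp only [coordField_self, zero_apply, h3, h4, Pi.zero_apply]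
  simp

/-- For horizontal `h`, the vector `(∇F_*)(u, h)` is orthogonal to `F_* h`. -/
theorem inner_secondFundamentalFormAt_self [T2Space M] {x : M} (u : TangentSpace I x)
    {h : TangentSpace I x} (hh : h ∈ (verticalSpace I J F x)ᗮ) :
    (inner ℝ (secondFundamentalFormAt hF.contMDiff x u h) (mfderiv I J F x h) : ℝ) = 0 := by
  obtain ⟨Y, hY, rfl, f, hf1, hf⟩ :=
    exists_isSmoothField_mfderiv_eq hF.contMDiff (hF.surjective_mfderiv x) h
  set q : E' := mfderiv I J F x (Y x) with hq
  set Q := coordField J (F x) q with hQ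
  have hYx := IsSmoothField.mdifferentiableAt hY x
  have hQx : MDiffAt (T% Q) (F x) := mdifferentiableAt_coordField (F x) q
  have hFx : MDiffAt F x := hF.contMDiff.mdifferentiable (by simp) x
  have hfQ : ∀ᶠ y in 𝓝 x, mfderiv I J F y (Y y) = Q (F y) := by
    filter_upwards [hf1] with y hy
    rw [hf y, hy, Pi.one_apply, one_smul]
  have hpush : pushCoord J F x Y =ᶠ[𝓝 x] fun _ ↦ q := by
    filter_upwards [hfQ, hF.contMDiff.continuous.continuousAt.preimage_mem_nhds
      ((chartAt H' (F x)).open_source.mem_nhds (mem_chart_source H' (F x)))] with y hy hyF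
    rw [pushCoord, TangentBundle.continuousLinearMapAt_trivializationAt hyF, hy]
    exact mvfderiv_extChartAt_coordField_of_mem hyF q
  have hsff : secondFundamentalFormAt hF.contMDiff x u (Y x)
      = leviCivita J Q (F x) (mfderiv I J F x u) - mfderiv I J F x (leviCivita I Y x u) := by
    have h1 := secondFundamentalFormAt_apply hF.contMDiff
      (mdifferentiableAt_coordField (J := I) x u) hYx
    have h2 : mvfderiv I (pushCoord J F x Y) x u = 0 := by
      have h3 : mvfderiv I (pushCoord J F x Y) x u = mvfderiv I (fun _ ↦ q) x u :=
        congrArg (fun L : TangentSpace I x →L[ℝ] E' ↦ L u) hpush.mfderiv_eq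
      rw [h3, mvfderiv_const, zero_apply]
    have h4 : coordField J (F x) 0 (F x) = 0 := map_zero _
    rw [coordField_self] at h1
    rw [h1, secondFundamentalForm_eq, coordField_self, h2, h4, zero_add, hpush.self_of_nhds]
  have hdA := mvfderiv_inner_self x hYx u
  have hdC := mvfderiv_inner_self (F x) hQx (mfderiv I J F x u)
  have hA : MDiffAt (fun y ↦ (inner ℝ (Y y) (Y y) : ℝ)) x := mdifferentiableAt_inner I hYx hYx
  have hC₀ : MDiffAt (fun z ↦ (inner ℝ (Q z) (Q z) : ℝ)) (F x) := mdifferentiableAt_inner J hQx hQx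
  have hC : MDiffAt ((fun z ↦ (inner ℝ (Q z) (Q z) : ℝ)) ∘ F) x := hC₀.comp x hFx
  have hcomp : mvfderiv I ((fun z ↦ (inner ℝ (Q z) (Q z) : ℝ)) ∘ F) x u
      = mvfderiv J (fun z ↦ (inner ℝ (Q z) (Q z) : ℝ)) (F x) (mfderiv I J F x u) :=
    mfderiv_comp_apply x hC₀ hFx u
  have hQF : Q (F x) = mfderiv I J F x (Y x) := hfQ.self_of_nhds.symm
  have hmin : IsLocalMin ((fun y ↦ (inner ℝ (Y y) (Y y) : ℝ))
      - (fun z ↦ (inner ℝ (Q z) (Q z) : ℝ)) ∘ F) x := by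
    filter_upwards [hfQ] with y hy
    simp only [Pi.sub_apply, Function.comp_apply]
    rw [hQF, hF.inner_mfderiv _ hh, sub_self, ← hy]
    have := hF.inner_mfderiv_self_le (Y y)
    linarith
  have hzero := mvfderiv_eq_zero_of_isLocalMin (hA.sub hC) hmin
  rw [mvfderiv_sub hA hC] at hzero
  have hzero' := congrArg (fun L : TangentSpace I x →L[ℝ] ℝ ↦ L u) hzero
  simp only [sub_apply, zero_apply] at hzero'
  rw [hcomp, hdA, hdC] at hzero'
  rw [hsff, inner_sub_left, hF.inner_mfderiv _ hh, ← hQF]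
  linarith

theorem inner_secondFundamentalFormAt_antisymm [T2Space M] {x : M} (u : TangentSpace I x)
    {h k : TangentSpace I x} (hh : h ∈ (verticalSpace I J F x)ᗮ)
    (hk : k ∈ (verticalSpace I J F x)ᗮ) :
    (inner ℝ (secondFundamentalFormAt hF.contMDiff x u h) (mfderiv I J F x k) : ℝ)
      = -inner ℝ (secondFundamentalFormAt hF.contMDiff x u k) (mfderiv I J F x h) := by
  have h1 := hF.inner_secondFundamentalFormAt_self u (Submodule.add_mem _ hh hk)
  have h2 := hF.inner_secondFundamentalFormAt_self u hh
  have h3 := hF.inner_secondFundamentalFormAt_self u hk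
  simp only [map_add, inner_add_left, inner_add_right] at h1
  linarith

/-- The second fundamental form of a Riemannian submersion vanishes on horizontal vectors. -/
theorem secondFundamentalFormAt_horizontal [T2Space M] {x : M} {h k : TangentSpace I x}
    (hh : h ∈ (verticalSpace I J F x)ᗮ) (hk : k ∈ (verticalSpace I J F x)ᗮ) :
    secondFundamentalFormAt hF.contMDiff x h k = 0 := by
  refine ext_inner_right ℝ fun q ↦ ?_
  obtain ⟨l, hl, rfl⟩ := hF.exists_horizontal_mfderiv_eq x q
  rw [inner_zero_left]
  have h1 := hF.inner_secondFundamentalFormAt_antisymm h hk hl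
  have h2 := hF.inner_secondFundamentalFormAt_antisymm l hh hk
  have h3 := hF.inner_secondFundamentalFormAt_antisymm k hl hh
  rw [secondFundamentalFormAt_comm hF.contMDiff h l] at h1
  rw [secondFundamentalFormAt_comm hF.contMDiff l k] at h2
  rw [secondFundamentalFormAt_comm hF.contMDiff k h] at h3
  linarith

end IsRiemannianSubmersion

end Submersion

section Sasakian

variable {E : Type*} [NormedAddCommGroup E] [NormedSpace ℝ E] [FiniteDimensional ℝ E]
  {H : Type*} [TopologicalSpace H] {I : ModelWithCorners ℝ E H} [I.Boundaryless]
  {M : Type*} [TopologicalSpace M] [ChartedSpace H M] [IsManifold I ∞ M]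
  [RiemannianBundle (fun x : M ↦ TangentSpace I x)]
  [IsContMDiffRiemannianBundle I ∞ E (fun x : M ↦ TangentSpace I x)]

theorem IsSmoothField.mlieBracket {X Y : Π x : M, TangentSpace I x} (hX : IsSmoothField I X)
    (hY : IsSmoothField I Y) : IsSmoothField I (mlieBracket I X Y) :=
  have : IsManifold I (minSmoothness ℝ 2) M := by
    rw [minSmoothness_of_isRCLikeNormedField]; infer_instance
  have : IsManifold I (((⊤ : ℕ∞) : WithTop ℕ∞) + 1) M := inferInstanceAs (IsManifold I ∞ M)
  ContDiff.mlieBracket_vectorField (m := ⊤) (n := ⊤) hX hY (by simp)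

theorem exists_isSmoothField_eq [T2Space M] {x : M} (w : TangentSpace I x) :
    ∃ Y : Π y : M, TangentSpace I y, IsSmoothField I Y ∧ Y x = w := by
  obtain ⟨Y, hY, hYx, -⟩ := exists_isSmoothField_mfderiv_eq (J := I) (F := (id : M → M))
    contMDiff_id (x := x) (by rw [mfderiv_id]; exact Function.surjective_id) w
  exact ⟨Y, hY, hYx⟩

theorem leviCivita_sub_comm {X Y : Π y : M, TangentSpace I y} {x : M} (hX : MDiffAt (T% X) x)
    (hY : MDiffAt (T% Y) x) :
    leviCivita I Y x (X x) - leviCivita I X x (Y x) = mlieBracket I X Y x :=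
  (CovariantDerivative.torsion_eq_zero_iff (cov := leviCivita I (M := M))).1
    (torsion_leviCivita I) hX hY

namespace AlmostContactMetricStructure

variable (S : AlmostContactMetricStructure I M)

theorem isSmoothField_phi {X : Π x : M, TangentSpace I x} (hX : IsSmoothField I X) :
    IsSmoothField I (S.phi X) :=
  ContMDiff.clm_bundle_apply (F₁ := E) (F₂ := E) (E₁ := fun x : M ↦ TangentSpace I x)
    (E₂ := fun x : M ↦ TangentSpace I x) (b := fun x : M ↦ x) (ϕ := S.φ) S.smooth_φ hX

theorem contMDiff_η {X : Π x : M, TangentSpace I x} (hX : IsSmoothField I X) :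
    CMDiff ∞ (fun y ↦ S.η y (X y)) := by
  have h : (fun y ↦ S.η y (X y)) = fun y ↦ (inner ℝ (X y) (S.ξ y) : ℝ) :=
    funext fun y ↦ S.η_eq_inner y _
  rw [h]
  exact ContMDiff.inner_bundle (F := E) (E := fun x : M ↦ TangentSpace I x) (b := fun x : M ↦ x)
    hX S.smooth_ξ

variable {S}

theorem two_mul_dη (X Y : Π x : M, TangentSpace I x) (x : M) :
    2 * S.dη X Y x = mvfderiv I (fun y ↦ S.η y (Y y)) x (X x)
      - mvfderiv I (fun y ↦ S.η y (X y)) x (Y x) - S.η x (mlieBracket I X Y x) := by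
  rw [dη]; ring

namespace IsSasakian

variable (hS : S.IsSasakian)
include hS

theorem mvfderiv_η_ξ {X : Π x : M, TangentSpace I x} (hX : IsSmoothField I X) (x : M) :
    mvfderiv I (fun y ↦ S.η y (X y)) x (S.ξ x) = S.η x (mlieBracket I S.ξ X x) := by
  have h := two_mul_dη (S := S) S.ξ X x
  rw [hS.contact _ _ S.smooth_ξ hX, real_inner_comm, ← S.η_eq_inner, S.η_φ] at h
  have h1 : (fun y ↦ S.η y (S.ξ y)) = fun _ ↦ (1 : ℝ) := funext fun y ↦ S.η_ξ y
  rw [h1, mvfderiv_const, zero_apply] at h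
  linarith

/-- The exterior derivative of `η` is invariant under the flow of `ξ`. -/
theorem mvfderiv_dη_ξ {X Y : Π x : M, TangentSpace I x} (hX : IsSmoothField I X)
    (hY : IsSmoothField I Y) (x : M) :
    mvfderiv I (fun y ↦ S.dη X Y y) x (S.ξ x)
      = S.dη (mlieBracket I S.ξ X) Y x + S.dη X (mlieBracket I S.ξ Y) x := by
  have hξx := IsSmoothField.mdifferentiableAt S.smooth_ξ x
  have hXx := IsSmoothField.mdifferentiableAt hX x
  have hYx := IsSmoothField.mdifferentiableAt hY x
  have hXY := IsSmoothField.mlieBracket hX hY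
  have ha := mvfderiv_mlieBracket (S.contMDiff_η hY).contMDiffAt hξx hXx
  have hb := mvfderiv_mlieBracket (S.contMDiff_η hX).contMDiffAt hξx hYx
  rw [funext (hS.mvfderiv_η_ξ hY)] at ha
  rw [funext (hS.mvfderiv_η_ξ hX)] at hb
  have hc := hS.mvfderiv_η_ξ hXY x
  have : IsManifold I (minSmoothness ℝ 3) M := by
    rw [minSmoothness_of_isRCLikeNormedField]; infer_instance
  have hJ := leibniz_identity_mlieBracket_apply (I := I) (x := x)
    ((ContMDiff.contMDiffAt S.smooth_ξ).of_le (by simpa using two_le_infty))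
    ((ContMDiff.contMDiffAt hX).of_le (by simpa using two_le_infty))
    ((ContMDiff.contMDiffAt hY).of_le (by simpa using two_le_infty))
  rw [hJ, map_add] at hc
  have h1 := two_mul_dη (S := S) (mlieBracket I S.ξ X) Y x
  have h2 := two_mul_dη (S := S) X (mlieBracket I S.ξ Y) x
  have h3 : (fun y ↦ S.dη X Y y) = (1 / 2 : ℝ) •
      ((fun y ↦ mvfderiv I (fun y ↦ S.η y (Y y)) y (X y))
        - (fun y ↦ mvfderiv I (fun y ↦ S.η y (X y)) y (Y y))
        - (fun y ↦ S.η y (mlieBracket I X Y y))) := rfl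
  have d1 := mdifferentiableAt_mvfderiv (S.contMDiff_η hY).contMDiffAt hXx
  have d2 := mdifferentiableAt_mvfderiv (S.contMDiff_η hX).contMDiffAt hYx
  have d3 : MDiffAt (fun y ↦ S.η y (mlieBracket I X Y y)) x :=
    (S.contMDiff_η hXY).mdifferentiable (by simp) x
  have h4 : mvfderiv I (fun y ↦ S.dη X Y y) x (S.ξ x) = (1 / 2 : ℝ) *
      (mvfderiv I (fun y ↦ mvfderiv I (fun y ↦ S.η y (Y y)) y (X y)) x (S.ξ x)
        - mvfderiv I (fun y ↦ mvfderiv I (fun y ↦ S.η y (X y)) y (Y y)) x (S.ξ x)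
        - mvfderiv I (fun y ↦ S.η y (mlieBracket I X Y y)) x (S.ξ x)) := by
    have h5 := mvfderiv_smul (I := I) (mdifferentiableAt_const (c := (1 / 2 : ℝ)) (x := x))
      ((d1.sub d2).sub d3)
    rw [h3]
    refine (congrArg (fun L : TangentSpace I x →L[ℝ] ℝ ↦ L (S.ξ x)) h5).trans ?_
    rw [mvfderiv_sub (d1.sub d2) d3, mvfderiv_sub d1 d2, mvfderiv_const]
    simp
  rw [h4]
  linarith

/-- The Lie derivative of `φ` along `ξ` takes values in the span of `ξ`. -/
theorem inner_mlieBracket_ξ_phi {Y : Π x : M, TangentSpace I x} (hY : IsSmoothField I Y) {x : M}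
    {v : TangentSpace I x} (hv : S.η x v = 0) :
    (inner ℝ v (mlieBracket I S.ξ (S.phi Y) x) : ℝ)
      = inner ℝ v (S.φ x (mlieBracket I S.ξ Y x)) := by
  have h := hS.normal Y S.ξ hY S.smooth_ξ x
  rw [hS.contact _ _ hY S.smooth_ξ, S.φ_ξ, inner_zero_right, mul_zero, zero_smul, add_zero,
    nijenhuis] at h
  have h1 : S.phi S.ξ = 0 := funext fun y ↦ S.φ_ξ y
  rw [h1, mlieBracket_zero_right, mlieBracket_zero_right, Pi.zero_apply, map_zero,
    add_zero, sub_zero, ← map_sub, mlieBracket_swap_apply (V := Y),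
    mlieBracket_swap_apply (V := S.phi Y)] at h
  set w := S.φ x (-mlieBracket I S.ξ Y x) - -mlieBracket I S.ξ (S.phi Y) x with hw
  have h2 := S.φ_φ x w
  rw [h, map_zero] at h2
  have h3 : w = S.η x w • S.ξ x := by
    rw [eq_comm, ← sub_eq_zero, sub_eq_neg_add]
    exact h2.symm
  have h4 : (inner ℝ v w : ℝ) = 0 := by
    rw [h3, inner_smul_right, ← S.η_eq_inner, hv, mul_zero]
  rw [hw, map_neg, inner_sub_right, inner_neg_right, inner_neg_right] at h4
  linarith

theorem inner_leviCivita_ξ_phi {X Y : Π x : M, TangentSpace I x} (hX : IsSmoothField I X)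
    (hY : IsSmoothField I Y) {x : M} (hXx : S.η x (X x) = 0) :
    (inner ℝ (leviCivita I S.ξ x (X x)) (S.φ x (Y x)) : ℝ)
      = inner ℝ (X x) (S.φ x (S.φ x (Y x))) := by
  have hφY := S.isSmoothField_phi hY
  have hξ' := IsSmoothField.mdifferentiableAt S.smooth_ξ x
  have hX' := IsSmoothField.mdifferentiableAt hX x
  have hφY' := IsSmoothField.mdifferentiableAt hφY x
  have h1 := hS.mvfderiv_dη_ξ hX hY x
  rw [funext (hS.contact X Y hX hY), hS.contact _ _ (S.smooth_ξ.mlieBracket hX) hY,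
    hS.contact _ _ hX (IsSmoothField.mlieBracket S.smooth_ξ hY),
    ← hS.inner_mlieBracket_ξ_phi hY hXx] at h1
  have h2 := mvfderiv_inner_leviCivita I hξ' hX' hφY'
  have h3 := leviCivita_sub_comm hξ' hX'
  have h4 := leviCivita_sub_comm hξ' hφY'
  have h5 := two_mul_dη (S := S) X (S.phi Y) x
  rw [hS.contact X _ hX hφY, ← leviCivita_sub_comm hX' hφY'] at h5
  have h6 : ∀ Z : Π y : M, TangentSpace I y,
      (fun y ↦ S.η y (Z y)) = fun y ↦ (inner ℝ (Z y) (S.ξ y) : ℝ) :=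
    fun Z ↦ funext fun y ↦ S.η_eq_inner y _
  rw [h6, h6, mvfderiv_inner_leviCivita I hX' hφY' hξ', mvfderiv_inner_leviCivita I hφY' hX' hξ',
    S.η_eq_inner, inner_sub_left] at h5
  rw [← h3, ← h4, inner_sub_left, inner_sub_right] at h1
  simp only [phi] at h1 h2 h5
  rw [real_inner_comm (leviCivita I S.ξ x (X x)) (S.φ x (Y x))] at h5
  linarith

theorem inner_leviCivita_ξ [T2Space M] {x : M} {v w : TangentSpace I x} (hv : S.η x v = 0)
    (hw : S.η x w = 0) :
    (inner ℝ (leviCivita I S.ξ x v) w : ℝ) = inner ℝ v (S.φ x w) := by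
  obtain ⟨X, hX, rfl⟩ := exists_isSmoothField_eq v
  obtain ⟨Y, hY, hYx⟩ := exists_isSmoothField_eq (-S.φ x w)
  have h := hS.inner_leviCivita_ξ_phi hX hY hv
  have h1 : S.φ x (-S.φ x w) = w := by
    rw [map_neg, S.φ_φ, hw, zero_smul, add_zero, neg_neg]
  rwa [hYx, h1] at h

end IsSasakian

end AlmostContactMetricStructure

end Sasakian

section AntiInvariantSubmersion

variable {E : Type*} [NormedAddCommGroup E] [NormedSpace ℝ E] [FiniteDimensional ℝ E]
  {H : Type*} [TopologicalSpace H] {I : ModelWithCorners ℝ E H} [I.Boundaryless]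
  {M : Type*} [TopologicalSpace M] [ChartedSpace H M] [IsManifold I ∞ M]
  [RiemannianBundle (fun x : M ↦ TangentSpace I x)]
  [IsContMDiffRiemannianBundle I ∞ E (fun x : M ↦ TangentSpace I x)]
  {E' : Type*} [NormedAddCommGroup E'] [NormedSpace ℝ E'] [FiniteDimensional ℝ E']
  {H' : Type*} [TopologicalSpace H'] {J : ModelWithCorners ℝ E' H'} [J.Boundaryless]
  {N : Type*} [TopologicalSpace N] [ChartedSpace H' N] [IsManifold J ∞ N]
  [RiemannianBundle (fun x : N ↦ TangentSpace J x)]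
  [IsContMDiffRiemannianBundle J ∞ E' (fun x : N ↦ TangentSpace J x)]

theorem vertPart_of_isVertical {F : M → N} {X : Π x : M, TangentSpace I x}
    (hX : IsVertical I J F X) : vertPart I J F X = X :=
  funext fun x ↦ Submodule.starProjection_eq_self_iff.2 (hX x)

theorem vertPart_of_isHorizontal {F : M → N} {X : Π x : M, TangentSpace I x}
    (hX : IsHorizontal I J F X) : vertPart I J F X = 0 :=
  funext fun x ↦ (Submodule.starProjection_apply_eq_zero_iff _).2 (hX x)

theorem horPart_of_isHorizontal {F : M → N} {X : Π x : M, TangentSpace I x}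
    (hX : IsHorizontal I J F X) : horPart I J F X = X :=
  funext fun x ↦ Submodule.starProjection_eq_self_iff.2 (hX x)

theorem nabla_zero (X : Π x : M, TangentSpace I x) : nabla I X 0 = 0 := by
  ext x
  rw [nabla, (leviCivita I).zero]
  rfl

theorem tensorT_of_isVertical_of_isHorizontal {F : M → N} {X Y : Π x : M, TangentSpace I x}
    (hX : IsVertical I J F X) (hY : IsHorizontal I J F Y) (x : M) :
    tensorT I J F X Y x = (verticalSpace I J F x).starProjection (leviCivita I Y x (X x)) := by
  rw [tensorT, vertPart_of_isVertical hX, vertPart_of_isHorizontal hY, horPart_of_isHorizontal hY,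
    nabla_zero, horPart, Pi.zero_apply, map_zero, zero_add]
  rfl

theorem tensorA_of_isHorizontal {F : M → N} {X Y : Π x : M, TangentSpace I x}
    (hX : IsHorizontal I J F X) (hY : IsHorizontal I J F Y) (x : M) :
    tensorA I J F X Y x = (verticalSpace I J F x).starProjection (leviCivita I Y x (X x)) := by
  rw [tensorA, horPart_of_isHorizontal hX, vertPart_of_isHorizontal hY, horPart_of_isHorizontal hY,
    nabla_zero, horPart, Pi.zero_apply, map_zero, add_zero]
  rfl

namespace IsRiemannianSubmersion

variable {F : M → N} (hF : IsRiemannianSubmersion I J F)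
include hF

theorem inner_secondFundamentalFormAt_vertical [T2Space M] {x : M} (w : TangentSpace I x)
    {u : TangentSpace I x} (hu : u ∈ verticalSpace I J F x) {Z : Π y : M, TangentSpace I y}
    (hZ : MDiffAt (T% Z) x) (hZh : IsHorizontal I J F Z) :
    (inner ℝ (secondFundamentalFormAt hF.contMDiff x w u) (mfderiv I J F x (Z x)) : ℝ)
      = inner ℝ u (leviCivita I Z x w) := by
  obtain ⟨U, hU, hUv, rfl⟩ := hF.exists_vertical_field hu
  have hUx := IsSmoothField.mdifferentiableAt hU x
  rw [hF.secondFundamentalFormAt_vertical w hUx hUv, inner_neg_left, hF.inner_mfderiv _ (hZh x)]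
  have h := mvfderiv_inner_leviCivita I (mdifferentiableAt_coordField (J := I) x w) hUx hZ
  have h0 : (fun y ↦ (inner ℝ (U y) (Z y) : ℝ)) = fun _ ↦ 0 :=
    funext fun y ↦ Submodule.inner_right_of_mem_orthogonal (hUv y) (hZh y)
  rw [coordField_self, h0, mvfderiv_const, zero_apply] at h
  linarith

theorem starProjection_leviCivita_eq_zero_iff [T2Space M] {x : M} (w : TangentSpace I x)
    {Z : Π y : M, TangentSpace I y} (hZ : MDiffAt (T% Z) x) (hZh : IsHorizontal I J F Z) :
    (verticalSpace I J F x).starProjection (leviCivita I Z x w) = 0 ↔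
      ∀ u ∈ verticalSpace I J F x,
        (inner ℝ (secondFundamentalFormAt hF.contMDiff x w u) (mfderiv I J F x (Z x)) : ℝ) = 0 := by
  rw [Submodule.starProjection_apply_eq_zero_iff, Submodule.mem_orthogonal]
  refine forall₂_congr fun u hu ↦ ?_
  rw [hF.inner_secondFundamentalFormAt_vertical w hu hZ hZh]

theorem isTotallyGeodesicMap_iff [T2Space M] :
    IsTotallyGeodesicMap I J F ↔ ∀ x (v w : TangentSpace I x),
      secondFundamentalFormAt hF.contMDiff x v w = 0 := by
  constructor
  · intro h x v w
    obtain ⟨X, hX, rfl⟩ := exists_isSmoothField_eq v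
    obtain ⟨Y, hY, rfl⟩ := exists_isSmoothField_eq w
    rw [secondFundamentalFormAt_apply hF.contMDiff (IsSmoothField.mdifferentiableAt hX x)
      (IsSmoothField.mdifferentiableAt hY x)]
    exact h X Y hX hY x
  · intro h X Y hX hY x
    rw [← secondFundamentalFormAt_apply hF.contMDiff (IsSmoothField.mdifferentiableAt hX x)
      (IsSmoothField.mdifferentiableAt hY x)]
    exact h x _ _

end IsRiemannianSubmersion

namespace IsAntiInvariantSubmersion

variable {S : AlmostContactMetricStructure I M} {F : M → N} (hF : IsAntiInvariantSubmersion J S F)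
include hF

theorem φ_mem {x : M} {v : TangentSpace I x} (hv : v ∈ verticalSpace I J F x) :
    S.φ x v ∈ (verticalSpace I J F x)ᗮ :=
  hF.anti_invariant x (Submodule.mem_map_of_mem hv)

theorem isHorizontal_phi {V : Π x : M, TangentSpace I x} (hV : IsVertical I J F V) :
    IsHorizontal I J F (S.phi V) :=
  fun x ↦ hF.φ_mem (hV x)

theorem inner_secondFundamentalFormAt_φ_of_tensorT [T2Space M]
    (hT : ∀ V W : Π x : M, TangentSpace I x, IsSmoothField I V → IsVertical I J F V →
      IsSmoothField I W → IsVertical I J F W → ∀ x, tensorT I J F W (S.phi V) x = 0)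
    {x : M} {u v w : TangentSpace I x} (hu : u ∈ verticalSpace I J F x)
    (hv : v ∈ verticalSpace I J F x) (hw : w ∈ verticalSpace I J F x) :
    (inner ℝ (secondFundamentalFormAt hF.isRiemannianSubmersion.contMDiff x w u)
      (mfderiv I J F x (S.φ x v)) : ℝ) = 0 := by
  obtain ⟨V, hV, hVv, rfl⟩ := hF.isRiemannianSubmersion.exists_vertical_field hv
  obtain ⟨W, hW, hWv, rfl⟩ := hF.isRiemannianSubmersion.exists_vertical_field hw
  have hh := hF.isHorizontal_phi hVv
  have h := hT V W hV hVv hW hWv x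
  rw [tensorT_of_isVertical_of_isHorizontal hWv hh] at h
  exact (hF.isRiemannianSubmersion.starProjection_leviCivita_eq_zero_iff _
    (IsSmoothField.mdifferentiableAt (S.isSmoothField_phi hV) x) hh).1 h u hu

variable (hξ : IsHorizontal I J F S.ξ)
include hξ

theorem η_eq_zero {x : M} {v : TangentSpace I x} (hv : v ∈ verticalSpace I J F x) :
    S.η x v = 0 := by
  rw [S.η_eq_inner]
  exact Submodule.inner_right_of_mem_orthogonal hv (hξ x)

theorem inner_secondFundamentalFormAt_ξ [T2Space M] {x : M} {v u : TangentSpace I x}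
    (hv : v ∈ verticalSpace I J F x) (hu : u ∈ verticalSpace I J F x) :
    (inner ℝ (secondFundamentalFormAt hF.isRiemannianSubmersion.contMDiff x v u)
      (mfderiv I J F x (S.ξ x)) : ℝ) = 0 := by
  rw [hF.isRiemannianSubmersion.inner_secondFundamentalFormAt_vertical v hu
    (IsSmoothField.mdifferentiableAt S.smooth_ξ x) hξ, real_inner_comm,
    hF.isSasakian.inner_leviCivita_ξ (hF.η_eq_zero hξ hv) (hF.η_eq_zero hξ hu)]
  exact Submodule.inner_right_of_mem_orthogonal hv (hF.φ_mem hu)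

theorem inner_secondFundamentalFormAt_φ_of_tensorA [T2Space M]
    (hA : ∀ X W : Π x : M, TangentSpace I x, IsSmoothField I X → IsHorizontal I J F X →
      IsSmoothField I W → IsVertical I J F W → ∀ x, tensorA I J F X (S.phi W) x = 0)
    {x : M} {u v w : TangentSpace I x} (hu : u ∈ verticalSpace I J F x)
    (hv : v ∈ verticalSpace I J F x) (c : ℝ) (hw : w ∈ verticalSpace I J F x) :
    (inner ℝ (secondFundamentalFormAt hF.isRiemannianSubmersion.contMDiff x
      (S.φ x v + c • S.ξ x) u) (mfderiv I J F x (S.φ x w)) : ℝ) = 0 := by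
  obtain ⟨V, hV, hVv, rfl⟩ := hF.isRiemannianSubmersion.exists_vertical_field hv
  obtain ⟨W, hW, hWv, rfl⟩ := hF.isRiemannianSubmersion.exists_vertical_field hw
  have hh := hF.isHorizontal_phi hWv
  have hX : IsSmoothField I (S.phi V + c • S.ξ) :=
    ContMDiff.add_section (S.isSmoothField_phi hV) (ContMDiff.const_smul_section S.smooth_ξ)
  have hXh : IsHorizontal I J F (S.phi V + c • S.ξ) := fun y ↦
    Submodule.add_mem _ (hF.isHorizontal_phi hVv y) (Submodule.smul_mem _ c (hξ y))
  have h := hA _ W hX hXh hW hWv x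
  rw [tensorA_of_isHorizontal hXh hh] at h
  exact (hF.isRiemannianSubmersion.starProjection_leviCivita_eq_zero_iff _
    (IsSmoothField.mdifferentiableAt (S.isSmoothField_phi hW) x) hh).1 h u hu

end IsAntiInvariantSubmersion

end AntiInvariantSubmersion

end

end SasakianSubmersion

open SasakianSubmersion Bundle in
theorem theorem12
    {E : Type*} [NormedAddCommGroup E] [NormedSpace ℝ E] [FiniteDimensional ℝ E]
    {M : Type*} [TopologicalSpace M] [T2Space M] [ChartedSpace E M] [IsManifold 𝓘(ℝ, E) ∞ M]
    [RiemannianBundle (fun x : M ↦ TangentSpace 𝓘(ℝ, E) x)]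
    [IsContMDiffRiemannianBundle 𝓘(ℝ, E) ∞ E (fun x : M ↦ TangentSpace 𝓘(ℝ, E) x)]
    {E' : Type*} [NormedAddCommGroup E'] [NormedSpace ℝ E'] [FiniteDimensional ℝ E']
    {N : Type*} [TopologicalSpace N] [T2Space N] [ChartedSpace E' N] [IsManifold 𝓘(ℝ, E') ∞ N]
    [RiemannianBundle (fun x : N ↦ TangentSpace 𝓘(ℝ, E') x)]
    [IsContMDiffRiemannianBundle 𝓘(ℝ, E') ∞ E' (fun x : N ↦ TangentSpace 𝓘(ℝ, E') x)]
    (S : AlmostContactMetricStructure 𝓘(ℝ, E) M) (F : M → N)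
    (hF : IsAntiInvariantSubmersion 𝓘(ℝ, E') S F)
    (hdecomp : ∀ x : M, (verticalSpace 𝓘(ℝ, E) 𝓘(ℝ, E') F x)ᗮ
      = (verticalSpace 𝓘(ℝ, E) 𝓘(ℝ, E') F x).map (S.φ x).toLinearMap
        ⊔ Submodule.span ℝ {S.ξ x}) :
    IsTotallyGeodesicMap 𝓘(ℝ, E) 𝓘(ℝ, E') F ↔
      (∀ V W : Π x : M, TangentSpace 𝓘(ℝ, E) x,
          IsSmoothField 𝓘(ℝ, E) V → IsVertical 𝓘(ℝ, E) 𝓘(ℝ, E') F V →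
          IsSmoothField 𝓘(ℝ, E) W → IsVertical 𝓘(ℝ, E) 𝓘(ℝ, E') F W →
          ∀ x, tensorT 𝓘(ℝ, E) 𝓘(ℝ, E') F W (S.phi V) x = 0) ∧
      (∀ X W : Π x : M, TangentSpace 𝓘(ℝ, E) x,
          IsSmoothField 𝓘(ℝ, E) X → IsHorizontal 𝓘(ℝ, E) 𝓘(ℝ, E') F X →
          IsSmoothField 𝓘(ℝ, E) W → IsVertical 𝓘(ℝ, E) 𝓘(ℝ, E') F W →
          ∀ x, tensorA 𝓘(ℝ, E) 𝓘(ℝ, E') F X (S.phi W) x = 0) := by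
  have hR := hF.isRiemannianSubmersion
  have hξ : IsHorizontal 𝓘(ℝ, E) 𝓘(ℝ, E') F S.ξ := fun x ↦ by
    rw [hdecomp x]
    exact Submodule.mem_sup_right (Submodule.mem_span_singleton_self _)
  have hmem : ∀ {x : M} {h : TangentSpace 𝓘(ℝ, E) x},
      h ∈ (verticalSpace 𝓘(ℝ, E) 𝓘(ℝ, E') F x)ᗮ →
      ∃ v ∈ verticalSpace 𝓘(ℝ, E) 𝓘(ℝ, E') F x, ∃ c : ℝ, h = S.φ x v + c • S.ξ x := by
    intro x h hh
    rw [hdecomp x, Submodule.mem_sup] at hh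
    obtain ⟨_, ⟨v, hv, rfl⟩, _, hz, rfl⟩ := hh
    obtain ⟨c, rfl⟩ := Submodule.mem_span_singleton.1 hz
    exact ⟨v, hv, c, rfl⟩
  rw [hR.isTotallyGeodesicMap_iff]
  refine ⟨fun hb ↦ ⟨fun V W hV hVv hW hWv x ↦ ?_, fun X W hX hXh hW hWv x ↦ ?_⟩,
    fun ⟨hT, hA⟩ x ↦ ?_⟩
  · have hh := hF.isHorizontal_phi hVv
    rw [tensorT_of_isVertical_of_isHorizontal hWv hh, hR.starProjection_leviCivita_eq_zero_iff _
      (IsSmoothField.mdifferentiableAt (S.isSmoothField_phi hV) x) hh]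
    intro u _
    rw [hb, inner_zero_left]
  · have hh := hF.isHorizontal_phi hWv
    rw [tensorA_of_isHorizontal hXh hh, hR.starProjection_leviCivita_eq_zero_iff _
      (IsSmoothField.mdifferentiableAt (S.isSmoothField_phi hW) x) hh]
    intro u _
    rw [hb, inner_zero_left]
  set b := secondFundamentalFormAt hR.contMDiff x with hbdef
  have hcomm : ∀ v w, b v w = b w v := secondFundamentalFormAt_comm hR.contMDiff
  have hvv : ∀ v ∈ verticalSpace 𝓘(ℝ, E) 𝓘(ℝ, E') F x,
      ∀ u ∈ verticalSpace 𝓘(ℝ, E) 𝓘(ℝ, E') F x, b v u = 0 := by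
    intro v hv u hu
    refine ext_inner_right ℝ fun q ↦ ?_
    obtain ⟨k, hk, rfl⟩ := hR.exists_horizontal_mfderiv_eq x q
    obtain ⟨w, hw, c, rfl⟩ := hmem hk
    rw [map_add, map_smul, inner_add_right, inner_smul_right, inner_zero_left,
      hF.inner_secondFundamentalFormAt_φ_of_tensorT hT hu hw hv,
      hF.inner_secondFundamentalFormAt_ξ hξ hv hu, mul_zero, add_zero]
  have hξξ : ∀ u : TangentSpace 𝓘(ℝ, E) x,
      (inner ℝ (b (S.ξ x) u) (mfderiv 𝓘(ℝ, E) 𝓘(ℝ, E') F x (S.ξ x)) : ℝ) = 0 := by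
    intro u
    rw [hcomm]
    exact hR.inner_secondFundamentalFormAt_self u (hξ x)
  have hφ : ∀ h ∈ (verticalSpace 𝓘(ℝ, E) 𝓘(ℝ, E') F x)ᗮ,
      ∀ u ∈ verticalSpace 𝓘(ℝ, E) 𝓘(ℝ, E') F x, ∀ w ∈ verticalSpace 𝓘(ℝ, E) 𝓘(ℝ, E') F x,
      (inner ℝ (b h u) (mfderiv 𝓘(ℝ, E) 𝓘(ℝ, E') F x (S.φ x w)) : ℝ) = 0 := by
    intro h hh u hu w hw
    obtain ⟨v, hv, c, rfl⟩ := hmem hh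
    exact hF.inner_secondFundamentalFormAt_φ_of_tensorA hξ hA hu hv c hw
  have hhv : ∀ h ∈ (verticalSpace 𝓘(ℝ, E) 𝓘(ℝ, E') F x)ᗮ,
      ∀ u ∈ verticalSpace 𝓘(ℝ, E) 𝓘(ℝ, E') F x, b h u = 0 := by
    intro h hh u hu
    have h1 : (inner ℝ (b h u) (mfderiv 𝓘(ℝ, E) 𝓘(ℝ, E') F x (S.ξ x)) : ℝ) = 0 := by
      have h2 := hR.inner_secondFundamentalFormAt_antisymm u hh (hξ x)
      rw [← hbdef, hcomm u h, hcomm u (S.ξ x)] at h2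
      rw [h2]
      obtain ⟨v, hv, c, rfl⟩ := hmem hh
      rw [map_add, map_smul, inner_add_right, inner_smul_right, hφ _ (hξ x) u hu v hv, hξξ,
        mul_zero, add_zero, neg_zero]
    refine ext_inner_right ℝ fun q ↦ ?_
    obtain ⟨k, hk, rfl⟩ := hR.exists_horizontal_mfderiv_eq x q
    obtain ⟨w, hw, c, rfl⟩ := hmem hk
    rw [map_add, map_smul, inner_add_right, inner_smul_right, inner_zero_left,
      hφ h hh u hu w hw, h1, mul_zero, add_zero]
  intro v w
  obtain ⟨v₁, hv₁, v₂, hv₂, rfl⟩ := hR.exists_horizontal x v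
  obtain ⟨w₁, hw₁, w₂, hw₂, rfl⟩ := hR.exists_horizontal x w
  have h4 : b v₂ w₂ = 0 := hR.secondFundamentalFormAt_horizontal hv₂ hw₂
  rw [map_add, map_add, add_apply, add_apply,
    hvv _ hv₁ _ hw₁, hhv _ hv₂ _ hw₁, hcomm v₁ w₂, hhv _ hw₂ _ hv₁, h4]
  simp
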